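/- Let $\mathbb K=\mathbb R$ or $\mathbb C$ and let $n\ge 1$. Equip $\mathbb K^{n\times(n+1)}$ with the Frobenius inner product $\mathrm{Re}\,\mathrm{trace}(N^*M)$ and $\mathbb K^{n+1}$ with the real part of the usual Hermitian product. For $M\in\mathbb K^{n\times(n+1)}$ let $\sigma_1(M)\ge\dots\ge\sigma_n(M)\ge 0$ be its singular values, and let $\mathbb{GL}^>_{n,n+1}$ be the set of $M\in\mathbb K^{n\times(n+1)}$ of rank $n$ with $\sigma_{n-1}(M)>\sigma_n(M)$ (the latter condition being void for $n=1$). Let $$\hat{\mathcal W}^>=\{(M,\zeta)\in\mathbb K^{n\times(n+1)}\times\mathbb K^{n+1}:\ \|M\|_F=1,\ \|\zeta\|=1,\ M\in\mathbb{GL}^>_{n,n+1},\ M\zeta=0\}.$$ Then $\hat{\mathcal W}^>$ is a smooth embedded submanifold of $\mathbb K^{n\times(n+1)}\times\mathbb K^{n+1}$; equip it with the Riemannian metric $\langle\cdot,\cdot\rangle$ induced by the product metric. The function $\alpha:\hat{\mathcal W}^>\to\mathbb R$, $\alpha(M,\zeta)=\sigma_n(M)^{-2}$, is self-convex, that is: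 $\alpha$ is of class $C^2$ with positive values, and for every geodesic $\gamma:I\to\hat{\mathcal W}^>$ ($I\subseteq\mathbb R$ an interval) of the Riemannian metric $\alpha\,\langle\cdot,\cdot\rangle$ on $\hat{\mathcal W}^>$, the function $t\mapsto\log\alpha(\gamma(t))$ is convex on $I$. -/

import Mathlib

noncomputable section

/-! ### Submanifolds of a Euclidean space, condition metrics and self-convexity

`E` is a real inner product space and `S ⊆ E` carries the Riemannian metric induced by `E`.
For a positive function `α` on `S`, the condition metric on `S` is
`⟪v, w⟫_{κ, x} = α x * ⟪v, w⟫`, so that its squared norm is `α x * ‖v‖ ^ 2`. -/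

section SelfConvexity

variable {E : Type*} [NormedAddCommGroup E] [InnerProductSpace ℝ E]

/-- `S` is a smooth embedded submanifold of `E` (without boundary, of some constant codimension
`k`): locally, `S` is the zero set of a smooth map to `ℝ ^ k` whose differential is onto. -/
def IsEmbeddedSubmanifold (S : Set E) : Prop :=
  ∃ k : ℕ, ∀ p ∈ S, ∃ (U : Set E) (F : E → EuclideanSpace ℝ (Fin k)),
    IsOpen U ∧ p ∈ U ∧ ContDiffOn ℝ ((⊤ : ℕ∞) : WithTop ℕ∞) F U ∧
      (∀ x ∈ U, Function.Surjective (fderiv ℝ F x)) ∧ S ∩ U = {x ∈ U | F x = 0}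

/-- The restriction of `α` to the submanifold `S` is of class `C²`: near each point of `S` it
agrees on `S` with a function of class `C²` on the ambient space. -/
def IsC2OnSubmanifold (S : Set E) (α : E → ℝ) : Prop :=
  ∀ p ∈ S, ∃ β : E → ℝ, ContDiffAt ℝ 2 β p ∧ β =ᶠ[nhdsWithin p S] α

/-- The energy on `[a, b]` of the curve `γ` for the condition metric `α ⟪·, ·⟫`. -/
def conditionEnergy (α : E → ℝ) (a b : ℝ) (γ : ℝ → E) : ℝ :=
  (1 / 2) * ∫ t in a..b, α (γ t) * ‖deriv γ t‖ ^ 2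

/-- `Γ` is a proper variation in `S` of the curve `γ` on `[a, b]`: a `C²` family of curves
`Γ s : [a, b] → S`, defined for small `|s|`, with the end points of `γ` and with `Γ 0 = γ`. -/
def IsProperVariation (S : Set E) (a b : ℝ) (γ : ℝ → E) (Γ : ℝ → ℝ → E) : Prop :=
  ∃ ε : ℝ, 0 < ε ∧
    ContDiffOn ℝ 2 (fun q : ℝ × ℝ => Γ q.1 q.2) (Set.Ioo (-ε) ε ×ˢ Set.Icc a b) ∧
    (∀ s ∈ Set.Ioo (-ε) ε, ∀ t ∈ Set.Icc a b, Γ s t ∈ S) ∧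
    (∀ s ∈ Set.Ioo (-ε) ε, Γ s a = γ a ∧ Γ s b = γ b) ∧
    ∀ t ∈ Set.Icc a b, Γ 0 t = γ t

/-- `γ : I → S` is a geodesic of `S` for the condition metric `α ⟪·, ·⟫`: a `C²` curve in `S`
which on each compact subinterval `[a, b]` of `I` is a critical point of the energy for the
variations in `S` with fixed end points. (Geodesics need not be minimizing.) -/
def IsConditionGeodesic (S : Set E) (α : E → ℝ) (I : Set ℝ) (γ : ℝ → E) : Prop :=
  ContDiffOn ℝ 2 γ I ∧ (∀ t ∈ I, γ t ∈ S) ∧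
    ∀ a b : ℝ, a < b → Set.Icc a b ⊆ I → ∀ Γ : ℝ → ℝ → E, IsProperVariation S a b γ Γ →
      HasDerivAt (fun s => conditionEnergy α a b (Γ s)) 0 0

/-- `α` is self-convex on the submanifold `S` of `E`: it is a `C²` function with positive values,
and `log ∘ α ∘ γ` is convex for each geodesic `γ` of the condition metric `α ⟪·, ·⟫` on `S`,
parametrized by any interval `I`. -/
structure IsSelfConvex (S : Set E) (α : E → ℝ) : Prop where
  c2 : IsC2OnSubmanifold S α
  pos : ∀ x ∈ S, 0 < α x
  convex : ∀ (I : Set ℝ) (γ : ℝ → E), I.OrdConnected → IsConditionGeodesic S α I γ →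
    ConvexOn ℝ I (fun t => Real.log (α (γ t)))

end SelfConvexity

/-! ### Singular values and the solution variety -/

section Matrices

variable {K : Type*} [RCLike K]

/-- The space `K ^ (n × m)` of matrices with the Frobenius inner product. -/
abbrev MatSpace (K : Type*) (n m : ℕ) : Type _ := EuclideanSpace K (Fin n × Fin m)

/-- The matrix with the entries `A (i, j)`. -/
def MatSpace.toMat {n m : ℕ} (A : MatSpace K n m) : Matrix (Fin n) (Fin m) K :=
  Matrix.of fun i j => A (i, j)

/-- `sigma k A` is the `k`-th singular value `σ_k(A)`, `k ≥ 1`, in the order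
`σ_1(A) ≥ σ_2(A) ≥ …` (Mathlib counts from `0`). -/
def sigma {n m : ℕ} (k : ℕ) (A : MatSpace K n m) : ℝ :=
  (Matrix.toEuclideanLin A.toMat).singularValues (k - 1)

/-- The set of `n × m` matrices (`1 ≤ n ≤ m`) of rank `n` whose smallest singular value `σ_n` is
simple, i.e. `σ_{n-1} > σ_n`; for `n = 1` the latter condition is void. -/
def GLgt (K : Type*) [RCLike K] (n m : ℕ) : Set (MatSpace K n m) :=
  {A | A.toMat.rank = n ∧ (2 ≤ n → sigma n A < sigma (n - 1) A)}

/-- The ambient space `K ^ (n × (n + 1)) × K ^ (n + 1)` with its product inner product. -/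
abbrev PairSpace (K : Type*) (n : ℕ) : Type _ :=
  WithLp 2 (MatSpace K n (n + 1) × EuclideanSpace K (Fin (n + 1)))

/-- The affine solution variety: the pairs `(M, ζ)` of elements of the unit spheres with
`M ∈ GLgt K n (n + 1)` and `M ζ = 0`. -/
def solutionVariety (K : Type*) [RCLike K] (n : ℕ) : Set (PairSpace K n) :=
  {w | ‖w.fst‖ = 1 ∧ ‖w.snd‖ = 1 ∧ w.fst ∈ GLgt K n (n + 1) ∧
    w.fst.toMat.mulVec w.snd.ofLp = 0}

end Matrices

end

/-! Write `r = σ_n(M)^2`, let `u` be a unit left singular vector for `σ_n`, and put `Q = (1 - u u^*)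
M`. Two facts about `Q` carry the proof. Convexity: `‖M‖^2 - σ_n(M)^2` is the maximum of the convex
functions `‖(1 - v v^*) M‖^2` over unit `v`, and half of it has gradient `Q`. Gradients of convex
functions are monotone, so `⟪M', Q'⟫ ≥ 0` along any curve
(`HasSimpleSmallest.inner_sub_resid_nonneg`). Admissible direction: `Q ζ = 0`, and for small `c` the
matrix `Z = M - c Q` has the same `σ_n` as `M`, since only the other singular values are scaled.
Normalizing `Z` and keeping `ζ` therefore stays in the variety, with `α = ‖Z‖^2 / r`
(`HasSimpleSmallest.normalize_mem_solutionVariety`). Vary a geodesic in this way with `c = s η(t)`,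
where `η` vanishes at the end points. The factor `‖Z‖^2` in `α` offsets the normalization: the
energy density is at most `(‖Z'‖^2 + ‖Z‖^2 ‖ζ'‖^2) / r`, with equality at `s = 0`. Criticality thus
gives `∫ (⟪M', W'⟫ + ⟪M, W⟫ ‖ζ'‖^2) / r = 0` for `W = η Q` (`integral_firstVariation_eq_zero`). With
`⟪M, Q⟫ = 1 - r`, `r' = -2 ⟪M', Q⟫`, `h = -log r` and an integration by parts, this reads `∫ η
((⟪M', Q'⟫ + (1 - r) ‖ζ'‖^2) / r - h'' / 2) = 0`. The fraction is nonnegative, so `h'' = (log α)''`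
cannot be negative near any point (`deriv_two_neg_log_nonneg`). The full geodesic equation is never
needed. Regularity of `u` comes from the implicit function theorem, and the submanifold property
from the regular equations `‖M‖ = 1`, `‖ζ‖ = 1`, `M ζ = 0`. -/

open Module Topology MeasureTheory

/-! ### Expansions in right singular vectors -/

section SingularBasis

variable {𝕜 : Type*} [RCLike 𝕜]
  {E : Type*} [NormedAddCommGroup E] [InnerProductSpace 𝕜 E] [FiniteDimensional 𝕜 E]
  {F : Type*} [NormedAddCommGroup F] [InnerProductSpace 𝕜 F] [FiniteDimensional 𝕜 F]

/-- The orthonormal basis of right singular vectors, in the order of `LinearMap.singularValues`. -/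
noncomputable def rightSingularBasis (T : E →ₗ[𝕜] F) {N : ℕ} (hN : finrank 𝕜 E = N) :
    OrthonormalBasis (Fin N) 𝕜 E :=
  T.isSymmetric_adjoint_comp_self.eigenvectorBasis hN

theorem adjoint_apply_rightSingularBasis (T : E →ₗ[𝕜] F) {N : ℕ} (hN : finrank 𝕜 E = N)
    (i : Fin N) :
    T.adjoint (T (rightSingularBasis T hN i)) =
      ((T.singularValues i ^ 2 : ℝ) : 𝕜) • rightSingularBasis T hN i := by
  rw [T.sq_singularValues_fin hN]
  exact T.isSymmetric_adjoint_comp_self.apply_eigenvectorBasis hN i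

theorem inner_apply_rightSingularBasis (T : E →ₗ[𝕜] F) {N : ℕ} (hN : finrank 𝕜 E = N)
    (i : Fin N) (x : E) :
    inner 𝕜 (T (rightSingularBasis T hN i)) (T x) =
      ((T.singularValues i ^ 2 : ℝ) : 𝕜) * inner 𝕜 (rightSingularBasis T hN i) x := by
  rw [← LinearMap.adjoint_inner_left, adjoint_apply_rightSingularBasis, inner_smul_left,
    RCLike.conj_ofReal]

theorem inner_rightSingularBasis_adjoint_apply (T : E →ₗ[𝕜] F) {N : ℕ} (hN : finrank 𝕜 E = N)
    (i : Fin N) (x : E) :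
    inner 𝕜 (rightSingularBasis T hN i) (T.adjoint (T x)) =
      ((T.singularValues i ^ 2 : ℝ) : 𝕜) * inner 𝕜 (rightSingularBasis T hN i) x := by
  rw [LinearMap.adjoint_inner_right, inner_apply_rightSingularBasis]

theorem norm_sq_adjoint_apply_eq_sum (T : E →ₗ[𝕜] F) {N : ℕ} (hN : finrank 𝕜 E = N) (x : E) :
    ‖T.adjoint (T x)‖ ^ 2 =
      ∑ i : Fin N, (T.singularValues i ^ 2) ^ 2 * ‖inner 𝕜 (rightSingularBasis T hN i) x‖ ^ 2 := by
  rw [← (rightSingularBasis T hN).sum_sq_norm_inner_right (T.adjoint (T x))]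
  refine Finset.sum_congr rfl fun i _ => ?_
  rw [inner_rightSingularBasis_adjoint_apply, norm_mul, mul_pow, RCLike.norm_ofReal, sq_abs]

theorem norm_sq_apply_eq_sum (T : E →ₗ[𝕜] F) {N : ℕ} (hN : finrank 𝕜 E = N) (x : E) :
    ‖T x‖ ^ 2 =
      ∑ i : Fin N, T.singularValues i ^ 2 * ‖inner 𝕜 (rightSingularBasis T hN i) x‖ ^ 2 := by
  have h : ‖T x‖ ^ 2 = RCLike.re (inner 𝕜 x (T.adjoint (T x))) := by
    rw [LinearMap.adjoint_inner_right, inner_self_eq_norm_sq]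
  rw [h, ← (rightSingularBasis T hN).sum_inner_mul_inner x, map_sum]
  refine Finset.sum_congr rfl fun i _ => ?_
  rw [inner_rightSingularBasis_adjoint_apply, mul_left_comm, RCLike.re_ofReal_mul,
    ← inner_conj_symm x, RCLike.conj_mul, ← RCLike.ofReal_pow, RCLike.ofReal_re]

theorem norm_sq_apply_rightSingularBasis (T : E →ₗ[𝕜] F) {N : ℕ} (hN : finrank 𝕜 E = N)
    (i : Fin N) : ‖T (rightSingularBasis T hN i)‖ ^ 2 = T.singularValues i ^ 2 := by
  have h := inner_apply_rightSingularBasis T hN i (rightSingularBasis T hN i)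
  rw [inner_self_eq_norm_sq_to_K, inner_self_eq_norm_sq_to_K, OrthonormalBasis.norm_eq_one] at h
  simp only [RCLike.ofReal_one, one_pow, mul_one] at h
  exact_mod_cast h

end SingularBasis

/-! ### Variational description of a simple smallest singular value -/

section Gap

variable {K : Type*} [RCLike K] {n m : ℕ}

theorem EuclideanSpace.real_inner_eq_re {ι : Type*} [Fintype ι] (x y : EuclideanSpace K ι) :
    inner ℝ x y = RCLike.re (inner K x y) := by
  simp only [PiLp.inner_apply, map_sum]
  rfl

/-- The action of the conjugate transpose of a matrix. -/
noncomputable def MatSpace.adj (A : MatSpace K n m) :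
    EuclideanSpace K (Fin n) →ₗ[K] EuclideanSpace K (Fin m) :=
  (Matrix.toEuclideanLin A.toMat).adjoint

theorem MatSpace.lin_apply (A : MatSpace K n m) (v : EuclideanSpace K (Fin m)) (i : Fin n) :
    Matrix.toEuclideanLin A.toMat v i = ∑ j, A (i, j) * v j := by
  simp [Matrix.toEuclideanLin, Matrix.mulVec, dotProduct, MatSpace.toMat]

theorem MatSpace.adj_apply (A : MatSpace K n m) (w : EuclideanSpace K (Fin n)) (j : Fin m) :
    A.adj w j = ∑ i, (starRingEnd K) (A (i, j)) * w i := by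
  rw [MatSpace.adj, ← Matrix.toEuclideanLin_conjTranspose_eq_adjoint]
  simp [Matrix.toEuclideanLin, Matrix.mulVec, dotProduct, MatSpace.toMat]

/-- `u` is a unit left singular vector of `A` for its smallest singular value, which is positive,
and the squares of the other singular values of `A` are at least `τ`, thus larger. -/
structure HasSimpleSmallest (A : MatSpace K n m) (u : EuclideanSpace K (Fin n)) (τ : ℝ) :
    Prop where
  norm_eq : ‖u‖ = 1
  pos : 0 < ‖A.adj u‖
  lt : ‖A.adj u‖ ^ 2 < τ
  orth : ∀ w, inner K u w = 0 → inner K (A.adj w) (A.adj u) = 0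
  le : ∀ w, inner K u w = 0 → τ * ‖w‖ ^ 2 ≤ ‖A.adj w‖ ^ 2

theorem MatSpace.finrank_range_lin (A : MatSpace K n m) :
    finrank K (Matrix.toEuclideanLin A.toMat).range = A.toMat.rank := by
  rw [show Matrix.toEuclideanLin A.toMat = _ from congrArg (· A.toMat) (Matrix.toLpLin_eq_toLin 2 2)]
  exact (Matrix.rank_eq_finrank_range_toLin _ _ _).symm

/-- Full rank makes every `w` of the form `A x`. With `b` the right singular vector for `σ_n`, take
`u = A b / σ_n`; then `w ⊥ u` means that `x` has no `b`-component, and the bound `τ σ_i^2 ≤ σ_i^4`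
can be checked coefficient by coefficient. -/
theorem exists_hasSimpleSmallest (hn : 1 ≤ n) (hm : n ≤ m) {A : MatSpace K n m}
    (hA : A ∈ GLgt K n m) : ∃ u τ, HasSimpleSmallest A u τ := by
  obtain ⟨hr, hgap⟩ := hA
  have hrange := A.finrank_range_lin.trans hr
  unfold sigma at hgap
  have hadj : A.adj = (Matrix.toEuclideanLin A.toMat).adjoint := rfl
  generalize Matrix.toEuclideanLin A.toMat = T at *
  have hN : finrank K (EuclideanSpace K (Fin m)) = m := by simp
  have hs : 0 < T.singularValues (n - 1) := by
    rw [T.singularValues_pos_iff_lt_finrank_range, hrange]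
    omega
  -- Counting from `0`, index `n - 1` is `σ_n` and `n - 2` is `σ_{n-1}`. For `n = 1` there is no
  -- other singular value to bound, and any larger `τ` will do.
  obtain ⟨τ, hτ, hτ'⟩ : ∃ τ, T.singularValues (n - 1) ^ 2 < τ ∧
      ∀ i < n - 1, τ ≤ T.singularValues i ^ 2 := by
    by_cases h2 : 2 ≤ n
    · refine ⟨T.singularValues (n - 2) ^ 2, ?_, fun i hi => ?_⟩
      · exact pow_lt_pow_left₀ (hgap h2) hs.le two_ne_zero
      · exact pow_le_pow_left₀ (T.singularValues_nonneg _)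
          (T.singularValues_antitone (by omega)) _
    · exact ⟨T.singularValues (n - 1) ^ 2 + 1, by linarith, fun i hi => by omega⟩
  have hsurj : Function.Surjective T := by
    rw [← LinearMap.range_eq_top]
    exact Submodule.eq_top_of_finrank_eq (by simp [hrange])
  set s := T.singularValues (n - 1) with hs_def
  set i₀ : Fin m := ⟨n - 1, by omega⟩
  set b := rightSingularBasis T hN
  have hs0 : (s : K) ≠ 0 := by exact_mod_cast hs.ne'
  have hnT : ‖T (b i₀)‖ = s := by
    have := norm_sq_apply_rightSingularBasis T hN i₀
    exact (pow_left_inj₀ (norm_nonneg _) hs.le two_ne_zero).1 this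
  have hadju : A.adj (((s : K)⁻¹) • T (b i₀)) = (s : K) • b i₀ := by
    rw [map_smul, hadj, adjoint_apply_rightSingularBasis, smul_smul]
    congr 1
    change (s : K)⁻¹ * ((s ^ 2 : ℝ) : K) = s
    push_cast
    field_simp
  have hnadj : ‖A.adj (((s : K)⁻¹) • T (b i₀))‖ = s := by
    rw [hadju, norm_smul, b.norm_eq_one, RCLike.norm_ofReal, abs_of_pos hs, mul_one]
  have hx : ∀ x, inner K ((s : K)⁻¹ • T (b i₀)) (T x) = 0 → inner K (b i₀) x = 0 := by
    intro x hx
    rw [inner_smul_left, inner_apply_rightSingularBasis] at hx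
    simpa [hs0, i₀, ← hs_def, hs.ne'] using hx
  refine ⟨(s : K)⁻¹ • T (b i₀), τ, ?_, ?_, ?_, ?_, ?_⟩
  · rw [norm_smul, hnT, norm_inv, RCLike.norm_ofReal, abs_of_pos hs, inv_mul_cancel₀ hs.ne']
  · rwa [hnadj]
  · rwa [hnadj]
  · intro w hw
    obtain ⟨x, rfl⟩ := hsurj w
    rw [hadju, inner_smul_right, ← inner_conj_symm, hadj, inner_rightSingularBasis_adjoint_apply,
      hx x hw]
    simp
  · intro w hw
    obtain ⟨x, rfl⟩ := hsurj w
    rw [hadj, norm_sq_apply_eq_sum T hN, norm_sq_adjoint_apply_eq_sum T hN, Finset.mul_sum]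
    refine Finset.sum_le_sum fun i _ => ?_
    rcases lt_trichotomy (i : ℕ) (n - 1) with hi | hi | hi
    · rw [← mul_assoc]
      refine mul_le_mul_of_nonneg_right ?_ (sq_nonneg _)
      rw [sq (_ ^ 2)]
      exact mul_le_mul_of_nonneg_right (hτ' i hi) (sq_nonneg _)
    · obtain rfl : i = i₀ := Fin.ext hi
      rw [hx x hw]
      simp
    · have : T.singularValues i = 0 := by
        rw [T.singularValues_eq_zero_iff_le_finrank_range, hrange]
        omega
      simp [this]

namespace HasSimpleSmallest

variable {A : MatSpace K n m} {u : EuclideanSpace K (Fin n)} {τ : ℝ}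

/-- Pythagoras for the splitting of `w` along `u` and its complement, which `A^*` keeps orthogonal.
This is how the minimality of `σ_n` enters later. -/
theorem le_norm_sq_adj (h : HasSimpleSmallest A u τ) (w : EuclideanSpace K (Fin n)) :
    ‖A.adj u‖ ^ 2 * ‖w‖ ^ 2 ≤ ‖A.adj w‖ ^ 2 := by
  set c := inner K u w
  set w' := w - c • u
  have hw : w = c • u + w' := by simp [w']
  have hort : inner K u w' = 0 := by
    simp only [w', inner_sub_right, inner_smul_right, inner_self_eq_norm_sq_to_K, h.norm_eq]
    simp [c]
  have h1 : ‖w‖ ^ 2 = ‖c‖ ^ 2 + ‖w'‖ ^ 2 := by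
    have : inner K (c • u) w' = 0 := by rw [inner_smul_left, hort, mul_zero]
    have := norm_add_sq_eq_norm_sq_add_norm_sq_of_inner_eq_zero _ _ this
    rw [← hw, norm_smul, h.norm_eq] at this
    nlinarith
  have h2 : ‖A.adj w‖ ^ 2 = ‖c‖ ^ 2 * ‖A.adj u‖ ^ 2 + ‖A.adj w'‖ ^ 2 := by
    have : inner K (c • A.adj u) (A.adj w') = 0 := by
      rw [inner_smul_left, ← inner_conj_symm, h.orth _ hort, map_zero, mul_zero]
    have := norm_add_sq_eq_norm_sq_add_norm_sq_of_inner_eq_zero _ _ this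
    rw [← map_smul, ← map_add, ← hw, map_smul, norm_smul] at this
    nlinarith
  rw [h1, h2]
  nlinarith [h.le w' hort, h.lt, sq_nonneg ‖w'‖]

theorem surjective (h : HasSimpleSmallest A u τ) :
    Function.Surjective (Matrix.toEuclideanLin A.toMat) := by
  rw [← LinearMap.range_eq_top, ← Submodule.orthogonal_eq_bot_iff, LinearMap.orthogonal_range,
    LinearMap.ker_eq_bot']
  intro w hw
  have h1 := h.le_norm_sq_adj w
  rw [MatSpace.adj, hw, norm_zero, zero_pow two_ne_zero] at h1
  have h2 := pow_pos h.pos 2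
  have h3 : ‖w‖ ^ 2 ≤ 0 := nonpos_of_mul_nonpos_right h1 h2
  simpa using le_antisymm h3 (sq_nonneg _)

theorem rank_eq (h : HasSimpleSmallest A u τ) : A.toMat.rank = n := by
  rw [← A.finrank_range_lin, LinearMap.range_eq_top.2 h.surjective, finrank_top]
  simp

/-- Both numbers minimize `‖A^* w‖ / ‖w‖`: each bound comes from testing one minimality against the
other minimizer, `u` or the image of the right singular vector for `σ_n`. -/
theorem sigma_eq (h : HasSimpleSmallest A u τ) (hn : 1 ≤ n) (hm : n ≤ m) :
    sigma n A = ‖A.adj u‖ := by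
  have hrange := A.finrank_range_lin.trans h.rank_eq
  have hsurj := h.surjective
  have hle := h.le_norm_sq_adj
  unfold sigma
  have hadj : A.adj = (Matrix.toEuclideanLin A.toMat).adjoint := rfl
  generalize Matrix.toEuclideanLin A.toMat = T at *
  have hN : finrank K (EuclideanSpace K (Fin m)) = m := by simp
  have hs : 0 < T.singularValues (n - 1) := by
    rw [T.singularValues_pos_iff_lt_finrank_range, hrange]
    omega
  refine (pow_left_inj₀ hs.le (norm_nonneg _) two_ne_zero).1 (le_antisymm ?_ ?_)
  · obtain ⟨x, rfl⟩ := hsurj u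
    have h1 := h.norm_eq
    have : T.singularValues (n - 1) ^ 2 * ‖T x‖ ^ 2 ≤ ‖T.adjoint (T x)‖ ^ 2 := by
      rw [norm_sq_apply_eq_sum T hN, norm_sq_adjoint_apply_eq_sum T hN, Finset.mul_sum]
      refine Finset.sum_le_sum fun i _ => ?_
      rw [← mul_assoc]
      refine mul_le_mul_of_nonneg_right ?_ (sq_nonneg _)
      rw [sq (_ ^ 2)]
      by_cases hi : (i : ℕ) ≤ n - 1
      · exact mul_le_mul_of_nonneg_right (pow_le_pow_left₀ hs.le (T.singularValues_antitone hi) _)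
          (sq_nonneg _)
      · have : T.singularValues i = 0 := by
          rw [T.singularValues_eq_zero_iff_le_finrank_range, hrange]
          omega
        simp [this]
    rwa [h1, one_pow, mul_one, ← hadj] at this
  · have := hle (T (rightSingularBasis T hN ⟨n - 1, by omega⟩))
    rw [norm_sq_apply_rightSingularBasis, hadj, adjoint_apply_rightSingularBasis, norm_smul,
      OrthonormalBasis.norm_eq_one, RCLike.norm_ofReal, mul_one, sq_abs, sq (_ ^ 2), ← hadj] at this
    exact le_of_mul_le_mul_right this (pow_pos hs 2)

/-- If the last two singular values agreed, the images of their right singular vectors would span a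
plane containing a nonzero vector orthogonal to `u`, on which `A^*` has squared ratio `σ_n^2 < τ`.
-/
theorem sigma_lt (h : HasSimpleSmallest A u τ) (hn : 2 ≤ n) (hm : n ≤ m) :
    sigma n A < sigma (n - 1) A := by
  have hsig := h.sigma_eq (by omega) hm
  have hpos := h.pos
  have hlt := h.lt
  have hle := h.le
  rw [← hsig] at hpos hlt
  unfold sigma at *
  have hadj : A.adj = (Matrix.toEuclideanLin A.toMat).adjoint := rfl
  generalize Matrix.toEuclideanLin A.toMat = T at *
  have hN : finrank K (EuclideanSpace K (Fin m)) = m := by simp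
  refine lt_of_le_of_ne (T.singularValues_antitone (by omega)) fun heq => ?_
  set b := rightSingularBasis T hN
  set i : Fin m := ⟨n - 1, by omega⟩
  set j : Fin m := ⟨n - 2, by omega⟩
  have hij : i ≠ j := by simp only [i, j, ne_eq, Fin.mk.injEq]; omega
  set s := T.singularValues (n - 1) with hs
  have hi : T.singularValues i = s := rfl
  have hj : T.singularValues j = s := heq.symm
  obtain ⟨p, q, hpq, hort⟩ : ∃ p q : K, 0 < ‖p‖ ^ 2 + ‖q‖ ^ 2 ∧
      inner K u (T (p • b i + q • b j)) = 0 := by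
    by_cases h0 : inner K u (T (b i)) = 0
    · exact ⟨1, 0, by simp, by simpa using h0⟩
    · refine ⟨inner K u (T (b j)), -inner K u (T (b i)), ?_, ?_⟩
      · have : 0 < ‖inner K u (T (b i))‖ := norm_pos_iff.2 h0
        rw [norm_neg]
        positivity
      · simp only [map_add, map_smul, inner_add_right, inner_smul_right]
        ring
  set x := p • b i + q • b j with hx
  have hTx : T.adjoint (T x) = ((s ^ 2 : ℝ) : K) • x := by
    have e1 : T.adjoint (T (b i)) = ((s ^ 2 : ℝ) : K) • b i :=
      adjoint_apply_rightSingularBasis T hN i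
    have e2 : T.adjoint (T (b j)) = ((s ^ 2 : ℝ) : K) • b j := by
      rw [← hj]
      exact adjoint_apply_rightSingularBasis T hN j
    simp only [hx, map_add, map_smul, e1, e2, smul_add, smul_comm p, smul_comm q]
  have hTx' : ‖T x‖ ^ 2 = s ^ 2 * ‖x‖ ^ 2 := by
    have : ‖T x‖ ^ 2 = RCLike.re (inner K x (T.adjoint (T x))) := by
      rw [LinearMap.adjoint_inner_right, inner_self_eq_norm_sq]
    rw [this, hTx, inner_smul_right, RCLike.re_ofReal_mul, inner_self_eq_norm_sq]
  have hxn : 0 < ‖x‖ ^ 2 := by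
    have h0 : inner K (p • b i) (q • b j) = 0 := by
      rw [inner_smul_left, inner_smul_right, b.orthonormal.2 hij]
      simp
    have := norm_add_sq_eq_norm_sq_add_norm_sq_of_inner_eq_zero _ _ h0
    rw [norm_smul, norm_smul, b.norm_eq_one, b.norm_eq_one] at this
    nlinarith
  have := hle _ hort
  rw [hadj, hTx, hTx', norm_smul, RCLike.norm_ofReal, mul_pow, sq_abs] at this
  have h3 : 0 < s ^ 2 * ‖x‖ ^ 2 := by positivity
  nlinarith

theorem mem_GLgt (h : HasSimpleSmallest A u τ) (hm : n ≤ m) : A ∈ GLgt K n m :=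
  ⟨h.rank_eq, fun hn => h.sigma_lt hn hm⟩

end HasSimpleSmallest

end Gap

/-! ### Matrix products as real bilinear maps, and the residual `(1 - u u^*) A` -/

section Bilinear

variable {K : Type*} [RCLike K] {n m : ℕ}

/-- `A.adj w` as a real bilinear map. -/
noncomputable def MatSpace.adjL :
    MatSpace K n m →L[ℝ] EuclideanSpace K (Fin n) →L[ℝ] EuclideanSpace K (Fin m) :=
  LinearMap.toContinuousBilinearMap <| LinearMap.mk₂ ℝ (fun A w => MatSpace.adj A w)
    (fun A B w => by
      ext j
      simp [MatSpace.adj_apply, add_mul, Finset.sum_add_distrib])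
    (fun c A w => by
      ext j
      simp [MatSpace.adj_apply, Finset.smul_sum, RCLike.real_smul_eq_coe_mul, mul_assoc])
    (fun A v w => map_add _ _ _)
    (fun c A w => by
      ext j
      simp [MatSpace.adj_apply, Finset.smul_sum])

@[simp]
theorem MatSpace.adjL_apply (A : MatSpace K n m) (w : EuclideanSpace K (Fin n)) :
    MatSpace.adjL A w = MatSpace.adj A w := rfl

/-- Matrix-vector multiplication as a real bilinear map. -/
noncomputable def MatSpace.linL :
    MatSpace K n m →L[ℝ] EuclideanSpace K (Fin m) →L[ℝ] EuclideanSpace K (Fin n) :=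
  LinearMap.toContinuousBilinearMap <| LinearMap.mk₂ ℝ
    (fun A v => Matrix.toEuclideanLin (MatSpace.toMat A) v)
    (fun A B w => by
      ext j
      simp [MatSpace.lin_apply, add_mul, Finset.sum_add_distrib])
    (fun c A w => by
      ext j
      simp [MatSpace.lin_apply, Finset.smul_sum])
    (fun A v w => map_add _ _ _)
    (fun c A w => by
      ext j
      simp [MatSpace.lin_apply, Finset.smul_sum])

theorem MatSpace.linL_apply (A : MatSpace K n m) (v : EuclideanSpace K (Fin m)) :
    MatSpace.linL A v = Matrix.toEuclideanLin A.toMat v := rfl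

/-- The rank one matrix `u y^*`. -/
noncomputable def MatSpace.outer (u : EuclideanSpace K (Fin n)) (y : EuclideanSpace K (Fin m)) :
    MatSpace K n m :=
  WithLp.toLp 2 fun p => u p.1 * (starRingEnd K) (y p.2)

/-- The rank one matrix `u y^*` as a real bilinear map. -/
noncomputable def MatSpace.outerL :
    EuclideanSpace K (Fin n) →L[ℝ] EuclideanSpace K (Fin m) →L[ℝ] MatSpace K n m :=
  LinearMap.toContinuousBilinearMap <| LinearMap.mk₂ ℝ MatSpace.outer
    (fun A B w => by ext j; simp [MatSpace.outer, add_mul])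
    (fun c A w => by ext j; simp [MatSpace.outer])
    (fun A v w => by ext j; simp [MatSpace.outer, mul_add])
    (fun c A w => by
      ext j
      simp [MatSpace.outer, RCLike.real_smul_eq_coe_mul, mul_left_comm])

@[simp]
theorem MatSpace.outerL_apply (u : EuclideanSpace K (Fin n)) (y : EuclideanSpace K (Fin m)) :
    MatSpace.outerL u y = MatSpace.outer u y := rfl

theorem MatSpace.inner_lin (A : MatSpace K n m) (w : EuclideanSpace K (Fin n))
    (v : EuclideanSpace K (Fin m)) :
    inner K w (MatSpace.linL A v) = inner K (A.adj w) v := by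
  rw [MatSpace.linL_apply, MatSpace.adj, LinearMap.adjoint_inner_left]

theorem MatSpace.inner_outer (u : EuclideanSpace K (Fin n)) (y : EuclideanSpace K (Fin m))
    (B : MatSpace K n m) :
    inner ℝ (MatSpace.outer u y) B = inner ℝ y (B.adj u) := by
  rw [EuclideanSpace.real_inner_eq_re, EuclideanSpace.real_inner_eq_re, ← RCLike.conj_re,
    inner_conj_symm]
  congr 1
  simp only [PiLp.inner_apply, MatSpace.outer, MatSpace.adj_apply, RCLike.inner_apply,
    Fintype.sum_prod_type, Finset.sum_mul]
  rw [Finset.sum_comm]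
  refine Finset.sum_congr rfl fun j _ => Finset.sum_congr rfl fun i _ => ?_
  ring

theorem MatSpace.adj_outer (u w : EuclideanSpace K (Fin n)) (y : EuclideanSpace K (Fin m)) :
    (MatSpace.outer u y).adj w = inner K u w • y := by
  ext j
  simp only [PiLp.inner_apply, MatSpace.outer, MatSpace.adj_apply, RCLike.inner_apply,
    PiLp.smul_apply, smul_eq_mul, Finset.sum_mul, map_mul, RCLike.conj_conj]
  refine Finset.sum_congr rfl fun j _ => ?_
  ring

theorem MatSpace.linL_outer (u : EuclideanSpace K (Fin n)) (y v : EuclideanSpace K (Fin m)) :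
    MatSpace.linL (MatSpace.outer u y) v = inner K y v • u := by
  ext j
  simp only [PiLp.inner_apply, MatSpace.outer, MatSpace.linL_apply, MatSpace.lin_apply,
    RCLike.inner_apply, PiLp.smul_apply, smul_eq_mul, Finset.sum_mul]
  refine Finset.sum_congr rfl fun j _ => ?_
  ring

theorem MatSpace.linL_apply_eq_zero_iff (A : MatSpace K n m) (v : EuclideanSpace K (Fin m)) :
    MatSpace.linL A v = 0 ↔ A.toMat.mulVec v.ofLp = 0 := by
  rw [MatSpace.linL_apply, ← (WithLp.ofLp_injective 2).eq_iff]
  rfl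

/-- The matrix `(1 - u u^*) A`. -/
noncomputable def MatSpace.resid (u : EuclideanSpace K (Fin n)) (A : MatSpace K n m) :
    MatSpace K n m :=
  A - MatSpace.outer u (A.adj u)

theorem MatSpace.adj_resid (u w : EuclideanSpace K (Fin n)) (A : MatSpace K n m) :
    (MatSpace.resid u A).adj w = A.adj w - inner K u w • A.adj u := by
  rw [← MatSpace.adjL_apply, MatSpace.resid, map_sub]
  simp [MatSpace.adj_outer]

theorem MatSpace.inner_resid (u : EuclideanSpace K (Fin n)) (A B : MatSpace K n m) :
    inner ℝ (MatSpace.resid u A) B = inner ℝ A B - inner ℝ (A.adj u) (B.adj u) := by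
  rw [MatSpace.resid, inner_sub_left, MatSpace.inner_outer]

theorem MatSpace.norm_sq_resid {u : EuclideanSpace K (Fin n)} (hu : ‖u‖ = 1)
    (A : MatSpace K n m) : ‖MatSpace.resid u A‖ ^ 2 = ‖A‖ ^ 2 - ‖A.adj u‖ ^ 2 := by
  rw [← real_inner_self_eq_norm_sq, MatSpace.inner_resid, MatSpace.adj_resid,
    inner_self_eq_norm_sq_to_K, hu, real_inner_comm, MatSpace.inner_resid]
  simp

/-- The inequality of the tangent line for the convex function `(‖A‖ ^ 2 - σ_n(A) ^ 2) / 2`, the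
gradient of which is `A ↦ MatSpace.resid u A`. -/
theorem MatSpace.inner_resid_le {u : EuclideanSpace K (Fin n)} (hu : ‖u‖ = 1)
    (A B : MatSpace K n m) :
    2 * inner ℝ (MatSpace.resid u A) B ≤
      (‖A‖ ^ 2 - ‖A.adj u‖ ^ 2) + (‖B‖ ^ 2 - ‖B.adj u‖ ^ 2) := by
  have h := MatSpace.norm_sq_resid hu (A - B)
  have h1 : (A - B).adj u = A.adj u - B.adj u := by
    simp only [← MatSpace.adjL_apply, map_sub, sub_apply]
  rw [h1, norm_sub_sq_real, norm_sub_sq_real] at h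
  rw [MatSpace.inner_resid]
  nlinarith [sq_nonneg ‖MatSpace.resid u (A - B)‖]

end Bilinear

/-! ### Monotonicity of the residual and deformation along it -/

namespace HasSimpleSmallest

variable {K : Type*} [RCLike K] {n m : ℕ} {A B : MatSpace K n m}
  {u v : EuclideanSpace K (Fin n)} {τ τ' : ℝ}

/-- Add the tangent line inequalities at `A` and at `B`; minimality replaces `‖B^* u‖` by `‖B^* v‖`
in the first, and `‖A^* v‖` by `‖A^* u‖` in the second. -/
theorem inner_sub_resid_nonneg (hA : HasSimpleSmallest A u τ) (hB : HasSimpleSmallest B v τ') :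
    0 ≤ inner ℝ (A - B) (MatSpace.resid u A - MatSpace.resid v B) := by
  have h1 := MatSpace.inner_resid_le hA.norm_eq A B
  have h2 := MatSpace.inner_resid_le hB.norm_eq B A
  have h3 := hA.le_norm_sq_adj v
  have h4 := hB.le_norm_sq_adj u
  rw [hA.norm_eq, hB.norm_eq] at *
  have h5 := MatSpace.inner_resid u A A
  have h6 := MatSpace.inner_resid v B B
  rw [real_inner_self_eq_norm_sq, real_inner_self_eq_norm_sq] at h5 h6
  rw [real_inner_comm, inner_sub_left, inner_sub_right, inner_sub_right]
  linarith

theorem sub_smul_resid_adj (hA : HasSimpleSmallest A u τ) (c : ℝ) :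
    (A - c • MatSpace.resid u A).adj u = A.adj u := by
  rw [← MatSpace.adjL_apply, map_sub, map_smul]
  simp [MatSpace.adj_resid, hA.norm_eq]

/-- The deformed matrix is `u u^* A + (1 - c) (1 - u u^*) A`: its adjoint agrees with `A^*` at `u`
and is `(1 - c) A^*` on the complement. -/
theorem sub_smul_resid (hA : HasSimpleSmallest A u τ) {c : ℝ}
    (hc : ‖A.adj u‖ ^ 2 < (1 - c) ^ 2 * τ) :
    HasSimpleSmallest (A - c • MatSpace.resid u A) u ((1 - c) ^ 2 * τ) := by
  have h : ∀ w, inner K u w = 0 → (A - c • MatSpace.resid u A).adj w = (1 - c) • A.adj w := by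
    intro w hw
    rw [← MatSpace.adjL_apply, map_sub, map_smul]
    simp [MatSpace.adj_resid, hw, sub_smul]
  refine ⟨hA.norm_eq, ?_, ?_, fun w hw => ?_, fun w hw => ?_⟩
  · rw [hA.sub_smul_resid_adj]
    exact hA.pos
  · rwa [hA.sub_smul_resid_adj]
  · rw [hA.sub_smul_resid_adj, h w hw, RCLike.real_smul_eq_coe_smul (K := K), inner_smul_left,
      hA.orth w hw, mul_zero]
  · rw [h w hw, norm_smul, mul_pow, Real.norm_eq_abs, sq_abs, mul_assoc]
    exact mul_le_mul_of_nonneg_left (hA.le w hw) (sq_nonneg _)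

theorem smul (hA : HasSimpleSmallest A u τ) {c : ℝ} (hc : c ≠ 0) :
    HasSimpleSmallest (c • A) u (c ^ 2 * τ) := by
  have h : ∀ w, (c • A).adj w = c • A.adj w := by
    intro w
    rw [← MatSpace.adjL_apply, map_smul]
    simp
  have hc2 : 0 < c ^ 2 := by positivity
  refine ⟨hA.norm_eq, ?_, ?_, fun w hw => ?_, fun w hw => ?_⟩
  · rw [h, norm_smul]
    exact mul_pos (norm_pos_iff.2 hc) hA.pos
  · rw [h, norm_smul, mul_pow, Real.norm_eq_abs, sq_abs]
    exact mul_lt_mul_of_pos_left hA.lt hc2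
  · rw [h, h, RCLike.real_smul_eq_coe_smul (K := K), RCLike.real_smul_eq_coe_smul (K := K),
      inner_smul_left, inner_smul_right, hA.orth w hw, mul_zero, mul_zero]
  · rw [h, norm_smul, mul_pow, Real.norm_eq_abs, sq_abs, mul_assoc]
    exact mul_le_mul_of_nonneg_left (hA.le w hw) hc2.le

/-! ### Smooth dependence of the singular vector on the matrix -/

theorem linL_adj (hA : HasSimpleSmallest A u τ) :
    MatSpace.linL A (A.adj u) = ((‖A.adj u‖ ^ 2 : ℝ) : K) • u := by
  refine ext_inner_left K fun w => ?_
  have hw : inner K u (w - inner K u w • u) = 0 := by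
    simp [inner_sub_right, inner_smul_right, hA.norm_eq]
  have h := hA.orth _ hw
  rw [map_sub, map_smul, inner_sub_left, sub_eq_zero, inner_smul_left,
    inner_self_eq_norm_sq_to_K] at h
  rw [MatSpace.inner_lin, h, inner_smul_right, inner_conj_symm]
  push_cast
  ring

/-- The equation for a left singular vector `u` of `A` and the square `l` of its singular value,
with the normalization `⟪u₀, u⟫ = 1`. -/
noncomputable def _root_.MatSpace.eigenEq (m : ℕ) (u₀ : EuclideanSpace K (Fin n))
    (x : MatSpace K n m × EuclideanSpace K (Fin n) × K) : EuclideanSpace K (Fin n) × K :=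
  (MatSpace.linL x.1 (MatSpace.adjL x.1 x.2.1) - x.2.2 • x.2.1,
    ((innerSL K u₀).restrictScalars ℝ) x.2.1)

theorem _root_.MatSpace.contDiff_eigenEq (u₀ : EuclideanSpace K (Fin n)) :
    ContDiff ℝ 2 (MatSpace.eigenEq m u₀) := by
  unfold MatSpace.eigenEq
  fun_prop

/-- For `(w, μ)` in the kernel, `w ⊥ u`; pairing with `u` gives `μ = 0`, and pairing with `w` gives
`‖A^* w‖^2 = σ_n^2 ‖w‖^2`, which the gap forbids unless `w = 0`. Finite dimension does the rest. -/
theorem isInvertible_fderiv_eigenEq (hA : HasSimpleSmallest A u τ) :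
    (fderiv ℝ (MatSpace.eigenEq m u) (A, u, ((‖A.adj u‖ ^ 2 : ℝ) : K)) ∘L
      .inr ℝ (MatSpace K n m) (EuclideanSpace K (Fin n) × K)).IsInvertible := by
  set l : K := ((‖A.adj u‖ ^ 2 : ℝ) : K) with hl
  set D := fderiv ℝ (MatSpace.eigenEq m u) (A, u, l) ∘L
      .inr ℝ (MatSpace K n m) (EuclideanSpace K (Fin n) × K) with hD
  have hDeq : ∀ y : EuclideanSpace K (Fin n) × K,
      D y = (MatSpace.linL A (A.adj y.1) - (l • y.1 + y.2 • u), inner K u y.1) := by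
    intro y
    have h1 : HasFDerivAt (MatSpace.eigenEq m u)
        (fderiv ℝ (MatSpace.eigenEq m u) (A, u, l)) (A, u, l) :=
      ((MatSpace.contDiff_eigenEq u).differentiable two_ne_zero _).hasFDerivAt
    have h2 : HasFDerivAt (fun z => MatSpace.eigenEq m u (A, z)) D (u, l) :=
      h1.comp (u, l) (hasFDerivAt_prodMk_right A (u, l))
    have h3 := (((MatSpace.linL A ∘L MatSpace.adjL A ∘L
      ContinuousLinearMap.fst ℝ (EuclideanSpace K (Fin n)) K).hasFDerivAt (x := (u, l))).sub
      ((hasFDerivAt_snd (𝕜 := ℝ) (p := (u, l))).smul hasFDerivAt_fst)).prodMk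
      ((((innerSL K u).restrictScalars ℝ) ∘L
        ContinuousLinearMap.fst ℝ (EuclideanSpace K (Fin n)) K).hasFDerivAt (x := (u, l)))
    rw [h2.unique h3]
    simp
  have hinj : Function.Injective D := by
    rw [injective_iff_map_eq_zero]
    rintro ⟨w, μ⟩ h
    rw [hDeq, Prod.mk_eq_zero] at h
    obtain ⟨h1, h2⟩ := h
    simp only at h1 h2
    have h3 : μ = 0 := by
      have := congrArg (inner K u) h1
      rw [inner_sub_right, inner_add_right, inner_smul_right, inner_smul_right, h2,
        MatSpace.inner_lin, ← inner_conj_symm, hA.orth w h2, inner_self_eq_norm_sq_to_K,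
        hA.norm_eq] at this
      simpa using this
    have h4 : w = 0 := by
      have := congrArg (inner K w) h1
      rw [h3, zero_smul, add_zero, inner_sub_right, inner_smul_right, MatSpace.inner_lin,
        inner_self_eq_norm_sq_to_K, inner_self_eq_norm_sq_to_K, inner_zero_right, sub_eq_zero,
        hl] at this
      have h5 : ‖A.adj w‖ ^ 2 = ‖A.adj u‖ ^ 2 * ‖w‖ ^ 2 := by exact_mod_cast this
      have h6 := hA.le w h2
      by_contra hw
      have h7 : 0 < ‖w‖ ^ 2 := by positivity
      nlinarith [hA.lt]
    rw [h3, h4]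
    rfl
  have hsurj : Function.Surjective D := LinearMap.surjective_of_injective (f := D.toLinearMap) hinj
  exact ⟨ContinuousLinearEquiv.ofBijective D (LinearMap.ker_eq_bot.2 hinj)
    (LinearMap.range_eq_top.2 hsurj), ContinuousLinearEquiv.coe_ofBijective _ _ _⟩

theorem eventually_le {u₀ : EuclideanSpace K (Fin n)} {A₀ : MatSpace K n m} {τ₀ : ℝ}
    (h₀ : HasSimpleSmallest A₀ u₀ τ₀) (hτ : τ < τ₀) (hτ0 : 0 ≤ τ) :
    ∀ᶠ x : MatSpace K n m × EuclideanSpace K (Fin n) in 𝓝 (A₀, u₀),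
      ∀ w, inner K x.2 w = 0 → τ * ‖w‖ ^ 2 ≤ ‖x.1.adj w‖ ^ 2 := by
  -- A lower bound for `‖A^* w‖ / ‖w‖` when `w ⊥ u`: the component of `w` along `u₀` is at most `‖u₀
  -- - u‖ ‖w‖`, and the change of matrix costs an operator norm.
  have hcont : Continuous fun x : MatSpace K n m × EuclideanSpace K (Fin n) =>
      √τ₀ * (1 - ‖u₀ - x.2‖) - ‖u₀ - x.2‖ * ‖A₀.adj u₀‖ -
        ‖(MatSpace.adjL A₀ - MatSpace.adjL x.1 :
          EuclideanSpace K (Fin n) →L[ℝ] EuclideanSpace K (Fin m))‖ := by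
    fun_prop
  have hlt : √τ < √τ₀ := Real.sqrt_lt_sqrt hτ0 hτ
  have hev := (hcont.tendsto (A₀, u₀)).eventually_const_lt (u := √τ) (by simpa using hlt)
  filter_upwards [hev] with x hx w hw
  set d := ‖u₀ - x.2‖
  set e := ‖(MatSpace.adjL A₀ - MatSpace.adjL x.1 :
          EuclideanSpace K (Fin n) →L[ℝ] EuclideanSpace K (Fin m))‖
  set c := inner K u₀ w
  set w' := w - c • u₀ with hw'
  have hc : ‖c‖ ≤ d * ‖w‖ := by
    have : c = inner K (u₀ - x.2) w := by rw [inner_sub_left, hw, sub_zero]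
    rw [this]
    exact norm_inner_le_norm _ _
  have hort : inner K u₀ w' = 0 := by
    simp [w', inner_sub_right, inner_smul_right, h₀.norm_eq, c]
  have h1 : ‖w‖ ≤ ‖w'‖ + ‖c‖ := by
    have : w = w' + c • u₀ := by simp [w']
    calc ‖w‖ = ‖w' + c • u₀‖ := by rw [← this]
      _ ≤ ‖w'‖ + ‖c • u₀‖ := norm_add_le _ _
      _ = ‖w'‖ + ‖c‖ := by rw [norm_smul, h₀.norm_eq, mul_one]
  have h2 : √τ₀ * ‖w'‖ ≤ ‖A₀.adj w'‖ := by
    have := Real.sqrt_le_sqrt (h₀.le w' hort)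
    rwa [Real.sqrt_mul (hτ0.trans hτ.le), Real.sqrt_sq (norm_nonneg _),
      Real.sqrt_sq (norm_nonneg _)] at this
  have h3 : ‖A₀.adj w'‖ ≤ ‖A₀.adj w‖ + ‖c‖ * ‖A₀.adj u₀‖ := by
    rw [hw', map_sub, map_smul, ← norm_smul]
    exact norm_sub_le _ _
  have h4 : ‖A₀.adj w‖ ≤ ‖x.1.adj w‖ + e * ‖w‖ := by
    have h5 : A₀.adj w = x.1.adj w + (MatSpace.adjL A₀ - MatSpace.adjL x.1) w := by simp
    rw [h5]
    exact (norm_add_le _ _).trans (by gcongr; exact ContinuousLinearMap.le_opNorm _ _)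
  have h5 : √τ * ‖w‖ ≤ ‖x.1.adj w‖ := by
    have e1 := mul_le_mul_of_nonneg_left hc (norm_nonneg (A₀.adj u₀))
    have e2 := mul_le_mul_of_nonneg_left (h1.trans (add_le_add_right hc _)) (Real.sqrt_nonneg τ₀)
    have e3 := mul_le_mul_of_nonneg_right hx.le (norm_nonneg w)
    nlinarith
  calc τ * ‖w‖ ^ 2 = (√τ * ‖w‖) ^ 2 := by rw [mul_pow, Real.sq_sqrt hτ0]
    _ ≤ _ := pow_le_pow_left₀ (by positivity) h5 2

/-- The implicit function gives eigenvectors of `A A^*`, whence `orth`; `eventually_le` carries the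
gap over. The numbers `ρ < τ` separate `σ_n^2` from the other squares uniformly near `A₀`, so that
one range of variation parameters serves all nearby matrices. -/
theorem exists_contDiffAt {u₀ : EuclideanSpace K (Fin n)} {A₀ : MatSpace K n m} {τ₀ : ℝ}
    (h₀ : HasSimpleSmallest A₀ u₀ τ₀) :
    ∃ (u : MatSpace K n m → EuclideanSpace K (Fin n)) (ρ τ : ℝ), ρ < τ ∧ ContDiffAt ℝ 2 u A₀ ∧
      ∀ᶠ A in 𝓝 A₀, HasSimpleSmallest A (u A) τ ∧ ‖A.adj (u A)‖ ^ 2 ≤ ρ := by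
  obtain ⟨τ, hτ, hττ⟩ := exists_between h₀.lt
  obtain ⟨ρ, hρ, hρτ⟩ := exists_between hτ
  have hf := (MatSpace.contDiff_eigenEq (m := m) u₀).contDiffAt
    (x := (A₀, u₀, ((‖A₀.adj u₀‖ ^ 2 : ℝ) : K)))
  have hinv := h₀.isInvertible_fderiv_eigenEq
  set ψ := hf.implicitFunction two_ne_zero hinv with hψ
  have hψ0 : ψ A₀ = (u₀, ((‖A₀.adj u₀‖ ^ 2 : ℝ) : K)) := hf.implicitFunction_apply_self _ _
  have hψc : ContDiffAt ℝ 2 ψ A₀ := hf.contDiffAt_implicitFunction two_ne_zero hinv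
  have hψe := hf.eventually_apply_implicitFunction two_ne_zero hinv
  set v := fun A => (ψ A).1
  have hv0 : v A₀ = u₀ := by simp [v, hψ0]
  have hu₀ : u₀ ≠ 0 := norm_ne_zero_iff.1 (by rw [h₀.norm_eq]; exact one_ne_zero)
  have hvc : ContDiffAt ℝ 2 v A₀ := hψc.fst
  have huc : ContDiffAt ℝ 2 (fun A => ‖v A‖⁻¹ • v A) A₀ :=
    ((hvc.norm ℝ (by rwa [hv0])).inv (by rwa [hv0, norm_ne_zero_iff])).smul hvc
  refine ⟨fun A => ‖v A‖⁻¹ • v A, ρ, τ, hρτ, huc, ?_⟩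
  have hu0 : ‖v A₀‖⁻¹ • v A₀ = u₀ := by rw [hv0, h₀.norm_eq, inv_one, one_smul]
  have hac : ContinuousAt (fun A : MatSpace K n m => MatSpace.adjL A (‖v A‖⁻¹ • v A)) A₀ :=
    (MatSpace.adjL (K := K) (n := n) (m := m)).continuous.continuousAt.clm_apply huc.continuousAt
  have hτ0 : 0 ≤ τ := (sq_nonneg _).trans hτ.le
  have hev : ∀ᶠ A in 𝓝 A₀, ∀ w, inner K (‖v A‖⁻¹ • v A) w = 0 →
      τ * ‖w‖ ^ 2 ≤ ‖MatSpace.adj A w‖ ^ 2 := by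
    have h := h₀.eventually_le hττ hτ0
    have ht : Filter.Tendsto (fun A : MatSpace K n m => (A, ‖v A‖⁻¹ • v A)) (𝓝 A₀)
        (𝓝 (A₀, u₀)) := by
      have := (continuousAt_id (x := A₀)).prodMk huc.continuousAt
      rwa [ContinuousAt, id, hu0] at this
    exact ht.eventually h
  have hpos := hac.norm.eventually_const_lt (u := 0) (by
    change 0 < ‖MatSpace.adj A₀ (‖v A₀‖⁻¹ • v A₀)‖
    rw [hu0]
    exact h₀.pos)
  have hle := (hac.norm.pow 2).eventually_lt_const (u := ρ) (by
    change ‖MatSpace.adj A₀ (‖v A₀‖⁻¹ • v A₀)‖ ^ 2 < ρ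
    rwa [hu0])
  filter_upwards [hψe, hev, hpos, hle] with A h1 h2 h3 h4
  have e1 := congrArg Prod.fst h1
  have e2 := congrArg Prod.snd h1
  simp only [MatSpace.eigenEq, MatSpace.adjL_apply, h₀.linL_adj, sub_self, sub_eq_zero] at e1
  have hv : v A ≠ 0 := by
    intro h
    simp only [MatSpace.eigenEq] at e2
    change innerSL K u₀ (v A) = innerSL K u₀ u₀ at e2
    rw [h, map_zero, innerSL_apply_apply, eq_comm, inner_self_eq_zero] at e2
    exact hu₀ e2
  refine ⟨⟨?_, h3, h4.trans hρτ, fun w hw => ?_, h2⟩, h4.le⟩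
  · rw [norm_smul, norm_inv, norm_norm, inv_mul_cancel₀ (norm_ne_zero_iff.2 hv)]
  · have hw' : inner K (v A) w = 0 := by
      rw [RCLike.real_smul_eq_coe_smul (K := K), inner_smul_left] at hw
      simpa [hv] using hw
    change MatSpace.linL A (MatSpace.adj A (v A)) = (ψ A).2 • v A at e1
    rw [RCLike.real_smul_eq_coe_smul (K := K), map_smul, inner_smul_right, ← MatSpace.inner_lin,
      e1, inner_smul_right, ← inner_conj_symm, hw']
    simp

end HasSimpleSmallest

/-! ### The solution variety as a regular zero set -/

theorem ContinuousLinearMap.isOpen_setOf_surjective {E F : Type*} [NormedAddCommGroup E]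
    [NormedSpace ℝ E] [NormedAddCommGroup F] [NormedSpace ℝ F] [FiniteDimensional ℝ F] :
    IsOpen {L : E →L[ℝ] F | Function.Surjective L} := by
  rw [isOpen_iff_mem_nhds]
  intro L hL
  obtain ⟨R, hR⟩ := L.exists_rightInverse_of_surjective (LinearMap.range_eq_top.2 hL)
  have hc : Continuous fun L' : E →L[ℝ] F => L' ∘L R := by fun_prop
  have hmem : Set.range ((↑) : (F ≃L[ℝ] F) → F →L[ℝ] F) ∈ 𝓝 (L ∘L R) := by
    rw [hR]
    have : CompleteSpace F := FiniteDimensional.complete ℝ F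
    exact ContinuousLinearEquiv.nhds (ContinuousLinearEquiv.refl ℝ F)
  filter_upwards [hc.continuousAt.preimage_mem_nhds hmem] with L' hL'
  obtain ⟨e, he⟩ := hL'
  intro y
  obtain ⟨z, rfl⟩ := e.surjective y
  exact ⟨R z, (DFunLike.congr_fun he z).symm⟩

section BilinearZeros

variable {E F G : Type*} [NormedAddCommGroup E] [InnerProductSpace ℝ E]
  [NormedAddCommGroup F] [InnerProductSpace ℝ F] [NormedAddCommGroup G] [NormedSpace ℝ G]

/-- The equations for the pairs of unit vectors at which a bilinear map vanishes. -/
noncomputable def unitZeroEq (B : E →L[ℝ] F →L[ℝ] G) (x : E × F) : ℝ × ℝ × G :=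
  (‖x.1‖ ^ 2 - 1, ‖x.2‖ ^ 2 - 1, B x.1 x.2)

theorem contDiff_unitZeroEq (B : E →L[ℝ] F →L[ℝ] G) {k : WithTop ℕ∞} :
    ContDiff ℝ k (unitZeroEq B) := by
  have h1 : ContDiff ℝ k fun x : E × F => ‖x.1‖ ^ 2 := contDiff_fst.norm_sq ℝ
  have h2 : ContDiff ℝ k fun x : E × F => ‖x.2‖ ^ 2 := contDiff_snd.norm_sq ℝ
  unfold unitZeroEq
  fun_prop

theorem unitZeroEq_eq_zero_iff (B : E →L[ℝ] F →L[ℝ] G) (x : E × F) :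
    unitZeroEq B x = 0 ↔ ‖x.1‖ = 1 ∧ ‖x.2‖ = 1 ∧ B x.1 x.2 = 0 := by
  simp only [unitZeroEq, Prod.mk_eq_zero, sub_eq_zero,
    pow_eq_one_iff_of_nonneg (norm_nonneg _) two_ne_zero]

/-- Radial motions of `M` and `ζ` give arbitrary derivatives of the two norms and do not affect `B M
ζ = 0` to first order; motion along `N ⊥ M` produces `v`. -/
theorem surjective_fderiv_unitZeroEq (B : E →L[ℝ] F →L[ℝ] G) {M : E} {ζ : F}
    (h : unitZeroEq B (M, ζ) = 0) (hB : ∀ v, ∃ N, inner ℝ M N = 0 ∧ B N ζ = v) :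
    Function.Surjective (fderiv ℝ (unitZeroEq B) (M, ζ)) := by
  rintro ⟨a, b, v⟩
  simp only [unitZeroEq, Prod.mk_eq_zero, sub_eq_zero] at h
  obtain ⟨hM, hζ, h0⟩ := h
  obtain ⟨N, hort, hN⟩ := hB v
  set M' := (a / 2) • M + N with hM'
  set ζ' := (b / 2) • ζ with hζ'
  have hcM : HasDerivAt (fun t : ℝ => M + t • M') M' 0 := by
    simpa using ((hasDerivAt_id (0 : ℝ)).smul_const M').const_add M
  have hcζ : HasDerivAt (fun t : ℝ => ζ + t • ζ') ζ' 0 := by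
    simpa using ((hasDerivAt_id (0 : ℝ)).smul_const ζ').const_add ζ
  have e1 : HasDerivAt (fun t : ℝ => ‖M + t • M'‖ ^ 2 - 1) a 0 := by
    have h := hcM.norm_sq.sub_const 1
    have : 2 * inner ℝ (M + (0 : ℝ) • M') M' = a := by
      rw [zero_smul, add_zero, hM', inner_add_right, hort, inner_smul_right,
        real_inner_self_eq_norm_sq, hM]
      ring
    rwa [this] at h
  have e2 : HasDerivAt (fun t : ℝ => ‖ζ + t • ζ'‖ ^ 2 - 1) b 0 := by
    have h := hcζ.norm_sq.sub_const 1
    have : 2 * inner ℝ (ζ + (0 : ℝ) • ζ') ζ' = b := by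
      rw [zero_smul, add_zero, hζ', inner_smul_right, real_inner_self_eq_norm_sq, hζ]
      ring
    rwa [this] at h
  have e3 : HasDerivAt (fun t : ℝ => B (M + t • M') (ζ + t • ζ')) v 0 := by
    have h := (B.hasFDerivAt.comp_hasDerivAt (0 : ℝ) hcM).clm_apply hcζ
    have : B M' (ζ + (0 : ℝ) • ζ') + B (M + (0 : ℝ) • M') ζ' = v := by
      rw [zero_smul, zero_smul, add_zero, add_zero, hM', hζ', map_smul, h0, smul_zero, add_zero,
        map_add, map_smul, add_apply, smul_apply, h0, smul_zero, zero_add, hN]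
    exact this ▸ h
  have h2 : HasDerivAt (fun t : ℝ => unitZeroEq B (M + t • M', ζ + t • ζ')) (a, b, v) 0 :=
    e1.prodMk (e2.prodMk e3)
  have hd : HasFDerivAt (unitZeroEq B) (fderiv ℝ (unitZeroEq B) (M, ζ))
      (M + (0 : ℝ) • M', ζ + (0 : ℝ) • ζ') := by
    rw [zero_smul, zero_smul, add_zero, add_zero]
    exact ((contDiff_unitZeroEq B).differentiable one_ne_zero _).hasFDerivAt
  have h3 := hd.comp_hasDerivAt (0 : ℝ) (hcM.prodMk hcζ)
  exact ⟨(M', ζ'), h3.unique h2⟩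

end BilinearZeros

section Submanifold

variable {K : Type*} [RCLike K] {n : ℕ}

theorem isOpen_GLgt {m : ℕ} (hn : 1 ≤ n) (hm : n ≤ m) : IsOpen (GLgt K n m) := by
  rw [isOpen_iff_mem_nhds]
  intro A hA
  obtain ⟨u, τ, h⟩ := exists_hasSimpleSmallest hn hm hA
  obtain ⟨v, ρ, τ', -, -, hev⟩ := h.exists_contDiffAt
  filter_upwards [hev] with B hB using hB.1.mem_GLgt hm

theorem isEmbeddedSubmanifold_solutionVariety (hn : 1 ≤ n) :
    IsEmbeddedSubmanifold (solutionVariety K n) := by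
  set e := WithLp.prodContinuousLinearEquiv 2 ℝ (MatSpace K n (n + 1))
    (EuclideanSpace K (Fin (n + 1)))
  set g := toEuclidean (E := ℝ × ℝ × EuclideanSpace K (Fin n))
  set B := MatSpace.linL (K := K) (n := n) (m := n + 1)
  have hdiff : ∀ w, DifferentiableAt ℝ (unitZeroEq B) w := fun w =>
    (contDiff_unitZeroEq B).differentiable one_ne_zero w
  have hiff : ∀ w : PairSpace K n, unitZeroEq B (e w) = 0 ↔
      ‖w.fst‖ = 1 ∧ ‖w.snd‖ = 1 ∧ w.fst.toMat.mulVec w.snd.ofLp = 0 := fun w => by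
    rw [← MatSpace.linL_apply_eq_zero_iff]
    exact unitZeroEq_eq_zero_iff B (e w)
  -- Regularity is required on all of the neighbourhood, not only on the variety, so the open
  -- condition of surjectivity is built into it.
  refine ⟨_, fun p hp => ⟨{w | w.fst ∈ GLgt K n (n + 1)} ∩
    {w | Function.Surjective (fderiv ℝ (unitZeroEq B) (e w))}, fun w => g (unitZeroEq B (e w)),
    ?_, ⟨hp.2.2.1, ?_⟩, ?_, ?_, ?_⟩⟩
  · refine IsOpen.inter ?_ ?_
    · exact (isOpen_GLgt hn n.le_succ).preimage (continuous_fst.comp e.continuous)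
    · exact ContinuousLinearMap.isOpen_setOf_surjective.preimage
        (((contDiff_unitZeroEq B).continuous_fderiv one_ne_zero).comp e.continuous)
  · have h := (hiff p).2 ⟨hp.1, hp.2.1, hp.2.2.2⟩
    -- The matrix `v ζ^*` sends the unit vector `ζ` to `v`, and is orthogonal to `M` because `M ζ =
    -- 0`.
    refine surjective_fderiv_unitZeroEq B h fun v => ⟨MatSpace.outer v p.snd, ?_, ?_⟩
    · change inner ℝ p.fst _ = 0
      rw [real_inner_comm, MatSpace.inner_outer, real_inner_comm,
        EuclideanSpace.real_inner_eq_re, ← MatSpace.inner_lin,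
        (MatSpace.linL_apply_eq_zero_iff _ _).2 hp.2.2.2, inner_zero_right, map_zero]
    · change B (MatSpace.outer v p.snd) p.snd = v
      rw [MatSpace.linL_outer, inner_self_eq_norm_sq_to_K, hp.2.1]
      simp
  · exact (g.contDiff.comp ((contDiff_unitZeroEq B).comp e.contDiff)).contDiffOn
  · intro w hw
    have : HasFDerivAt (fun w => g (unitZeroEq B (e w))) _ w :=
      g.hasFDerivAt.comp w ((hdiff (e w)).hasFDerivAt.comp w e.hasFDerivAt)
    rw [this.fderiv]
    exact g.surjective.comp (hw.2.comp e.surjective)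
  · ext w
    have := hiff w
    simp only [Set.mem_inter_iff, Set.mem_ofPred_eq, map_eq_zero_iff _ g.injective,
      solutionVariety, this]
    tauto

end Submanifold

/-! ### Calculus of curves -/

section Calculus

theorem ContDiffAt.deriv_of_two {F : Type*} [NormedAddCommGroup F] [NormedSpace ℝ F]
    {f : ℝ → F} {t : ℝ} (hf : ContDiffAt ℝ 2 f t) : ContDiffAt ℝ 1 (deriv f) t :=
  (hf.fderiv_right (m := 1) (by norm_num [one_add_one_eq_two])).clm_apply contDiffAt_const

/-- The normalization `Z / ‖Z‖` of a curve is at most `1 / ‖Z‖` times as fast as `Z`. -/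
theorem exists_hasDerivAt_normalize {X : Type*} [NormedAddCommGroup X] [InnerProductSpace ℝ X]
    {Z : ℝ → X} {Z' : X} {t : ℝ} (hZ : HasDerivAt Z Z' t) (h0 : Z t ≠ 0) :
    ∃ D, HasDerivAt (fun x => ‖Z x‖⁻¹ • Z x) D t ∧ ‖Z t‖ ^ 2 * ‖D‖ ^ 2 ≤ ‖Z'‖ ^ 2 := by
  have hn : ‖Z t‖ ≠ 0 := norm_ne_zero_iff.2 h0
  have hd : DifferentiableAt ℝ (fun x => ‖Z x‖⁻¹) t :=
    (hZ.differentiableAt.norm ℝ h0).inv hn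
  set c := deriv (fun x => ‖Z x‖⁻¹) t
  have hD := hd.hasDerivAt.fun_smul hZ
  refine ⟨_, hD, ?_⟩
  set D := ‖Z t‖⁻¹ • Z' + c • Z t
  have hev : (fun x => ‖(‖Z x‖⁻¹ • Z x)‖ ^ 2) =ᶠ[𝓝 t] fun _ => 1 := by
    filter_upwards [hZ.continuousAt.eventually_ne h0] with x hx
    rw [norm_smul, norm_inv, norm_norm, inv_mul_cancel₀ (norm_ne_zero_iff.2 hx), one_pow]
  have hort := (hD.norm_sq.congr_of_eventuallyEq hev.symm).unique (hasDerivAt_const t 1)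
  rw [inner_smul_left] at hort
  have hort' : inner ℝ (Z t) D = 0 := by simpa [hn] using hort
  have hZ' : Z' = ‖Z t‖ • D - (‖Z t‖ * c) • Z t := by
    simp only [D, smul_add, smul_smul, mul_inv_cancel₀ hn]
    simp
  have h2 : ‖Z'‖ ^ 2 = ‖Z t‖ ^ 2 * ‖D‖ ^ 2 + (‖Z t‖ * c) ^ 2 * ‖Z t‖ ^ 2 := by
    rw [hZ', norm_sub_sq_real, inner_smul_left, inner_smul_right, real_inner_comm, hort',
      norm_smul, norm_smul, mul_pow, mul_pow, Real.norm_eq_abs, Real.norm_eq_abs, sq_abs, sq_abs]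
    simp
  rw [h2]
  nlinarith [sq_nonneg (‖Z t‖ * c * ‖Z t‖)]

/-- A parabola touching `f` from above has the same slope. An upper bound for the energy thus
suffices, with no differentiation under the integral. -/
theorem eq_zero_of_hasDerivAt_zero_of_le {f : ℝ → ℝ} {c₁ c₂ : ℝ} (hf : HasDerivAt f 0 0)
    (hle : ∀ᶠ s in 𝓝 0, f s ≤ f 0 + s * c₁ + s ^ 2 * c₂) : c₁ = 0 := by
  have hmin : IsLocalMin (fun s => f 0 + s * c₁ + s ^ 2 * c₂ - f s) 0 := by
    filter_upwards [hle] with s hs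
    simpa using hs
  have hd : HasDerivAt (fun s => f 0 + s * c₁ + s ^ 2 * c₂ - f s) c₁ 0 := by
    have h1 : HasDerivAt (fun s : ℝ => f 0 + s * c₁) (1 * c₁) 0 :=
      ((hasDerivAt_id (0 : ℝ)).mul_const c₁).const_add (f 0)
    have h2 : HasDerivAt (fun s : ℝ => s ^ 2 * c₂) _ 0 := (hasDerivAt_pow 2 (0 : ℝ)).mul_const c₂
    exact ((h1.fun_add h2).fun_sub hf).congr_deriv (by simp)
  exact hmin.hasDerivAt_eq_zero hd

theorem inner_deriv_nonneg_of_monotone {X : Type*} [NormedAddCommGroup X] [InnerProductSpace ℝ X]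
    {M Q : ℝ → X} {M' Q' : X} {t : ℝ} (hM : HasDerivAt M M' t) (hQ : HasDerivAt Q Q' t)
    (h : ∀ᶠ s in 𝓝 t, 0 ≤ inner ℝ (M s - M t) (Q s - Q t)) : 0 ≤ inner ℝ M' Q' := by
  rw [hasDerivAt_iff_tendsto_slope] at hM hQ
  refine ge_of_tendsto (hM.inner hQ) ?_
  filter_upwards [h.filter_mono nhdsWithin_le_nhds] with s hs
  rw [slope_def_module, slope_def_module, inner_smul_left, inner_smul_right, ← mul_assoc]
  exact mul_nonneg (mul_self_nonneg _) hs

end Calculus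

/-! ### First variation of the condition energy -/

section FirstVariation

variable {X Y : Type*} [NormedAddCommGroup X] [InnerProductSpace ℝ X]
  [NormedAddCommGroup Y] [InnerProductSpace ℝ Y]

theorem ContDiffAt.fst_ofLp {γ : ℝ → WithLp 2 (X × Y)} {t : ℝ} (h : ContDiffAt ℝ 2 γ t) :
    ContDiffAt ℝ 2 (fun t => (γ t).fst) t :=
  contDiff_fst.contDiffAt.comp t
    ((WithLp.prodContinuousLinearEquiv 2 ℝ X Y).contDiff.contDiffAt.comp t h)

theorem ContDiffAt.snd_ofLp {γ : ℝ → WithLp 2 (X × Y)} {t : ℝ} (h : ContDiffAt ℝ 2 γ t) :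
    ContDiffAt ℝ 2 (fun t => (γ t).snd) t :=
  contDiff_snd.contDiffAt.comp t
    ((WithLp.prodContinuousLinearEquiv 2 ℝ X Y).contDiff.contDiffAt.comp t h)

theorem HasDerivAt.toLp_prodMk {f : ℝ → X} {g : ℝ → Y} {f' : X} {g' : Y} {t : ℝ}
    (hf : HasDerivAt f f' t) (hg : HasDerivAt g g' t) :
    HasDerivAt (fun t => WithLp.toLp 2 (f t, g t)) (WithLp.toLp 2 (f', g')) t :=
  (WithLp.prodContinuousLinearEquiv 2 ℝ X Y).symm.hasFDerivAt.comp_hasDerivAt t (hf.prodMk hg)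

/-- The curve `t ↦ (M t, ζ t)` is varied by normalizing `M t - s • W t`. -/
noncomputable def normalizedVariation (γ : ℝ → WithLp 2 (X × Y)) (W : ℝ → X) (s t : ℝ) :
    WithLp 2 (X × Y) :=
  WithLp.toLp 2 (‖(γ t).fst - s • W t‖⁻¹ • ((γ t).fst - s • W t), (γ t).snd)

theorem isProperVariation_normalizedVariation {S : Set (WithLp 2 (X × Y))}
    {γ : ℝ → WithLp 2 (X × Y)} {W : ℝ → X} {a b ε : ℝ} (hε : 0 < ε)
    (hγ : ∀ t ∈ Set.Icc a b, ContDiffAt ℝ 2 γ t) (hW : ∀ t ∈ Set.Icc a b, ContDiffAt ℝ 2 W t)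
    (hM : ∀ t ∈ Set.Icc a b, ‖(γ t).fst‖ = 1) (hWa : W a = 0) (hWb : W b = 0) (hab : a ≤ b)
    (hZ : ∀ s ∈ Set.Ioo (-ε) ε, ∀ t ∈ Set.Icc a b, (γ t).fst - s • W t ≠ 0)
    (hS : ∀ s ∈ Set.Ioo (-ε) ε, ∀ t ∈ Set.Icc a b, normalizedVariation γ W s t ∈ S) :
    IsProperVariation S a b γ (normalizedVariation γ W) := by
  have h0 : ∀ t ∈ Set.Icc a b, ∀ s, s • W t = 0 → normalizedVariation γ W s t = γ t := by
    intro t ht s hs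
    rw [normalizedVariation, hs, sub_zero, hM t ht, inv_one, one_smul]
    rfl
  refine ⟨ε, hε, ?_, hS, fun s _ => ⟨h0 a (Set.left_mem_Icc.2 hab) s (by rw [hWa, smul_zero]),
    h0 b (Set.right_mem_Icc.2 hab) s (by rw [hWb, smul_zero])⟩,
    fun t ht => h0 t ht 0 (zero_smul _ _)⟩
  rintro ⟨s, t⟩ ⟨hs, ht⟩
  have hM' : ContDiffAt ℝ 2 (fun q : ℝ × ℝ => (γ q.2).fst) (s, t) :=
    ContDiffAt.comp (g := fun t => (γ t).fst) (f := Prod.snd) (s, t) (hγ t ht).fst_ofLp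
      contDiffAt_snd
  have hζ' : ContDiffAt ℝ 2 (fun q : ℝ × ℝ => (γ q.2).snd) (s, t) :=
    ContDiffAt.comp (g := fun t => (γ t).snd) (f := Prod.snd) (s, t) (hγ t ht).snd_ofLp
      contDiffAt_snd
  have hW' : ContDiffAt ℝ 2 (fun q : ℝ × ℝ => W q.2) (s, t) :=
    (hW t ht).comp (s, t) contDiffAt_snd
  have hZ' : ContDiffAt ℝ 2 (fun q : ℝ × ℝ => (γ q.2).fst - q.1 • W q.2) (s, t) :=
    hM'.sub (contDiffAt_fst.smul hW')
  have hN := (((hZ'.norm ℝ (hZ s hs t ht)).inv (norm_ne_zero_iff.2 (hZ s hs t ht))).smul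
    hZ').prodMk hζ'
  exact ((WithLp.prodContinuousLinearEquiv 2 ℝ X Y).symm.contDiff.contDiffAt.comp (s, t)
    hN).contDiffWithinAt

/-- By `exists_hasDerivAt_normalize` and the form of `α`, the energy lies below a quadratic
polynomial in `s` with equality at `s = 0`; its linear coefficient, minus the integral below, must
vanish. -/
theorem integral_firstVariation_eq_zero {S : Set (WithLp 2 (X × Y))} {α : WithLp 2 (X × Y) → ℝ}
    {I : Set ℝ} {γ : ℝ → WithLp 2 (X × Y)} (hgeo : IsConditionGeodesic S α I γ) {W : ℝ → X}
    {r : ℝ → ℝ} {a b ε : ℝ} (hε : 0 < ε) (hab : a < b) (hI : Set.Icc a b ⊆ I)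
    (hγ : ∀ t ∈ Set.Icc a b, ContDiffAt ℝ 2 γ t) (hW : ∀ t ∈ Set.Icc a b, ContDiffAt ℝ 2 W t)
    (hr : ContinuousOn r (Set.Icc a b)) (hr0 : ∀ t ∈ Set.Icc a b, 0 < r t)
    (hM : ∀ t ∈ Set.Icc a b, ‖(γ t).fst‖ = 1) (hWa : W a = 0) (hWb : W b = 0)
    (hZ : ∀ s ∈ Set.Ioo (-ε) ε, ∀ t ∈ Set.Icc a b, (γ t).fst - s • W t ≠ 0)
    (hS : ∀ s ∈ Set.Ioo (-ε) ε, ∀ t ∈ Set.Icc a b, normalizedVariation γ W s t ∈ S)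
    (hα : ∀ s ∈ Set.Ioo (-ε) ε, ∀ t ∈ Set.Icc a b,
      α (normalizedVariation γ W s t) = ‖(γ t).fst - s • W t‖ ^ 2 / r t) :
    ∫ t in a..b, (inner ℝ (deriv (fun t => (γ t).fst) t) (deriv W t) +
      inner ℝ (γ t).fst (W t) * ‖deriv (fun t => (γ t).snd) t‖ ^ 2) / r t = 0 := by
  have hcrit := hgeo.2.2 a b hab hI _
    (isProperVariation_normalizedVariation hε hγ hW hM hWa hWb hab.le hZ hS)
  set M := fun t => (γ t).fst with hMdef
  set ζ := fun t => (γ t).snd with hζdef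
  have hMc : ∀ t ∈ Set.Icc a b, ContDiffAt ℝ 2 M t := fun t ht => (hγ t ht).fst_ofLp
  have hζc : ∀ t ∈ Set.Icc a b, ContDiffAt ℝ 2 ζ t := fun t ht => (hγ t ht).snd_ofLp
  have cM : ContinuousOn M (Set.Icc a b) :=
    fun t ht => (hMc t ht).continuousAt.continuousWithinAt
  have cW : ContinuousOn W (Set.Icc a b) :=
    fun t ht => (hW t ht).continuousAt.continuousWithinAt
  have cM' : ContinuousOn (deriv M) (Set.Icc a b) :=
    fun t ht => (hMc t ht).deriv_of_two.continuousAt.continuousWithinAt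
  have cζ' : ContinuousOn (deriv ζ) (Set.Icc a b) :=
    fun t ht => (hζc t ht).deriv_of_two.continuousAt.continuousWithinAt
  have cW' : ContinuousOn (deriv W) (Set.Icc a b) :=
    fun t ht => (hW t ht).deriv_of_two.continuousAt.continuousWithinAt
  have hr1 : ∀ t ∈ Set.Icc a b, r t ≠ 0 := fun t ht => (hr0 t ht).ne'
  set p₀ := fun t => (‖deriv M t‖ ^ 2 + ‖deriv ζ t‖ ^ 2) / r t
  set p₁ := fun t => (inner ℝ (deriv M t) (deriv W t) + inner ℝ (M t) (W t) * ‖deriv ζ t‖ ^ 2) / r t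
  set p₂ := fun t => (‖deriv W t‖ ^ 2 + ‖W t‖ ^ 2 * ‖deriv ζ t‖ ^ 2) / r t
  have c₀ : ContinuousOn p₀ (Set.Icc a b) := ((cM'.norm.pow 2).add (cζ'.norm.pow 2)).div hr hr1
  have c₁ : ContinuousOn p₁ (Set.Icc a b) :=
    ((cM'.inner cW').add ((cM.inner cW).mul (cζ'.norm.pow 2))).div hr hr1
  have c₂ : ContinuousOn p₂ (Set.Icc a b) :=
    ((cW'.norm.pow 2).add ((cW.norm.pow 2).mul (cζ'.norm.pow 2))).div hr hr1
  have i₀ := c₀.intervalIntegrable_of_Icc (μ := volume) hab.le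
  have i₁ := c₁.intervalIntegrable_of_Icc (μ := volume) hab.le
  have i₂ := c₂.intervalIntegrable_of_Icc (μ := volume) hab.le
  change ∫ t in a..b, p₁ t = 0
  have hpt : ∀ s ∈ Set.Ioo (-ε) ε, ∀ t ∈ Set.Ioo a b,
      0 ≤ α (normalizedVariation γ W s t) * ‖deriv (normalizedVariation γ W s) t‖ ^ 2 ∧
      α (normalizedVariation γ W s t) * ‖deriv (normalizedVariation γ W s) t‖ ^ 2 ≤
        p₀ t + s * (-2 * p₁ t) + s ^ 2 * p₂ t := by
    intro s hs t ht'
    have ht := Set.Ioo_subset_Icc_self ht'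
    have hZd : HasDerivAt (fun t => M t - s • W t) (deriv M t - s • deriv W t) t :=
      ((hMc t ht).differentiableAt two_ne_zero).hasDerivAt.sub
        (((hW t ht).differentiableAt two_ne_zero).hasDerivAt.const_smul s)
    obtain ⟨D, hD, hDle⟩ := exists_hasDerivAt_normalize hZd (hZ s hs t ht)
    have hΓ := hD.toLp_prodMk ((hζc t ht).differentiableAt two_ne_zero).hasDerivAt
    have hd : deriv (normalizedVariation γ W s) t = WithLp.toLp 2 (D, deriv ζ t) := hΓ.deriv
    have hrt := hr0 t ht
    rw [hα s hs t ht, hd, WithLp.prod_norm_sq_eq_of_L2]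
    refine ⟨by positivity, ?_⟩
    change ‖M t - s • W t‖ ^ 2 / r t * (‖D‖ ^ 2 + ‖deriv ζ t‖ ^ 2) ≤ _
    have e1 : ‖M t - s • W t‖ ^ 2 = 1 - 2 * s * inner ℝ (M t) (W t) + s ^ 2 * ‖W t‖ ^ 2 := by
      rw [norm_sub_sq_real, inner_smul_right, norm_smul, mul_pow, Real.norm_eq_abs, sq_abs,
        show ‖M t‖ = 1 from hM t ht]
      ring
    have e2 : ‖deriv M t - s • deriv W t‖ ^ 2 = ‖deriv M t‖ ^ 2 -
        2 * s * inner ℝ (deriv M t) (deriv W t) + s ^ 2 * ‖deriv W t‖ ^ 2 := by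
      rw [norm_sub_sq_real, inner_smul_right, norm_smul, mul_pow, Real.norm_eq_abs, sq_abs]
      ring
    calc ‖M t - s • W t‖ ^ 2 / r t * (‖D‖ ^ 2 + ‖deriv ζ t‖ ^ 2)
        = (‖M t - s • W t‖ ^ 2 * ‖D‖ ^ 2 + ‖M t - s • W t‖ ^ 2 * ‖deriv ζ t‖ ^ 2) / r t := by ring
      _ ≤ (‖deriv M t - s • deriv W t‖ ^ 2 + ‖M t - s • W t‖ ^ 2 * ‖deriv ζ t‖ ^ 2) / r t := by
          gcongr
      _ = p₀ t + s * (-2 * p₁ t) + s ^ 2 * p₂ t := by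
          rw [e1, e2]
          simp only [p₀, p₁, p₂]
          ring
  have hint : ∀ s : ℝ, ∫ t in a..b, (p₀ t + s * (-2 * p₁ t) + s ^ 2 * p₂ t) =
      (∫ t in a..b, p₀ t) + s * (-2 * ∫ t in a..b, p₁ t) + s ^ 2 * ∫ t in a..b, p₂ t := by
    intro s
    rw [intervalIntegral.integral_add (i₀.add ((i₁.const_mul _).const_mul _)) (i₂.const_mul _),
      intervalIntegral.integral_add i₀ ((i₁.const_mul _).const_mul _)]
    simp only [intervalIntegral.integral_const_mul]
  have hE0 : conditionEnergy α a b (normalizedVariation γ W 0) = 1 / 2 * ∫ t in a..b, p₀ t := by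
    rw [conditionEnergy]
    congr 1
    -- On the open interval `‖M‖ = 1` holds near each point, so the varied curve at `s = 0` has the
    -- derivative of `γ`.
    rw [intervalIntegral.integral_of_le hab.le, intervalIntegral.integral_of_le hab.le,
      integral_Ioc_eq_integral_Ioo, integral_Ioc_eq_integral_Ioo]
    refine setIntegral_congr_fun measurableSet_Ioo fun t ht' => ?_
    have ht := Set.Ioo_subset_Icc_self ht'
    have hev : normalizedVariation γ W 0 =ᶠ[𝓝 t] fun t => WithLp.toLp 2 (M t, ζ t) := by
      filter_upwards [Icc_mem_nhds ht'.1 ht'.2] with x hx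
      rw [normalizedVariation, zero_smul, sub_zero, hM x hx, inv_one, one_smul]
    have hΓ := ((hMc t ht).differentiableAt two_ne_zero).hasDerivAt.toLp_prodMk
      ((hζc t ht).differentiableAt two_ne_zero).hasDerivAt
    rw [hα 0 ⟨neg_lt_zero.2 hε, hε⟩ t ht, hev.deriv_eq, hΓ.deriv, WithLp.prod_norm_sq_eq_of_L2,
      zero_smul, sub_zero, hM t ht]
    simp only [p₀]
    change 1 ^ 2 / r t * (‖deriv M t‖ ^ 2 + ‖deriv ζ t‖ ^ 2) = _
    ring
  have hE : ∀ᶠ s in 𝓝 0, conditionEnergy α a b (normalizedVariation γ W s) ≤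
      conditionEnergy α a b (normalizedVariation γ W 0) + s * (-∫ t in a..b, p₁ t) +
        s ^ 2 * (1 / 2 * ∫ t in a..b, p₂ t) := by
    filter_upwards [Ioo_mem_nhds (neg_lt_zero.2 hε) hε] with s hs
    have hle : ∫ t in a..b, α (normalizedVariation γ W s t) *
        ‖deriv (normalizedVariation γ W s) t‖ ^ 2 ≤
        ∫ t in a..b, (p₀ t + s * (-2 * p₁ t) + s ^ 2 * p₂ t) := by
      have hi := (i₀.add ((i₁.const_mul (-2)).const_mul s)).add (i₂.const_mul (s ^ 2))
      rw [intervalIntegrable_iff_integrableOn_Ioo_of_le hab.le] at hi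
      rw [intervalIntegral.integral_of_le hab.le, intervalIntegral.integral_of_le hab.le,
        integral_Ioc_eq_integral_Ioo, integral_Ioc_eq_integral_Ioo]
      -- Only the upper bound has to be integrable.
      refine integral_mono_of_nonneg ?_ hi ?_
      · exact (ae_restrict_iff' measurableSet_Ioo).2 (.of_forall fun t ht => (hpt s hs t ht).1)
      · exact (ae_restrict_iff' measurableSet_Ioo).2 (.of_forall fun t ht => (hpt s hs t ht).2)
    rw [hint] at hle
    rw [hE0, conditionEnergy]
    linarith
  have := eq_zero_of_hasDerivAt_zero_of_le hcrit hE
  linarith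

end FirstVariation

/-! ### The second derivative of `-log r` along a geodesic -/

section Core

theorem ContDiffAt.continuousAt_deriv_of_one {F : Type*} [NormedAddCommGroup F] [NormedSpace ℝ F]
    {f : ℝ → F} {t : ℝ} (hf : ContDiffAt ℝ 1 f t) : ContinuousAt (deriv f) t :=
  ((hf.continuousAt_fderiv one_ne_zero).clm_apply continuousAt_const)

theorem Filter.Eventually.exists_Icc {p : ℝ → Prop} {t₀ : ℝ} (h : ∀ᶠ t in 𝓝 t₀, p t) :
    ∃ a b, a < t₀ ∧ t₀ < b ∧ ∀ t ∈ Set.Icc a b, p t := by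
  obtain ⟨l, u, ht, hlu⟩ := mem_nhds_iff_exists_Ioo_subset.1 h
  refine ⟨(l + t₀) / 2, (t₀ + u) / 2, by linarith [ht.1], by linarith [ht.2], fun t h => hlu ?_⟩
  exact ⟨by linarith [h.1, ht.1], by linarith [h.2, ht.2]⟩

variable {X Y : Type*} [NormedAddCommGroup X] [InnerProductSpace ℝ X]
  [NormedAddCommGroup Y] [InnerProductSpace ℝ Y]

/-- A negative second derivative would persist on some `[a, b]` around `t₀`; the first variation in
the direction `η Q` would then be an integral that is both zero and positive. -/
theorem deriv_two_neg_log_nonneg {S : Set (WithLp 2 (X × Y))} {α : WithLp 2 (X × Y) → ℝ}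
    {I : Set ℝ} {γ : ℝ → WithLp 2 (X × Y)} (hgeo : IsConditionGeodesic S α I γ) {Q : ℝ → X}
    {r : ℝ → ℝ} {t₀ δ : ℝ} (hδ : 0 < δ) (hI : I ∈ 𝓝 t₀) (hγ : ContDiffAt ℝ 2 γ t₀)
    (hQ : ContDiffAt ℝ 2 Q t₀) (hr : ContDiffAt ℝ 2 r t₀)
    (hM : ∀ᶠ t in 𝓝 t₀, ‖(γ t).fst‖ = 1)
    (hrt : ∀ᶠ t in 𝓝 t₀, 0 < r t ∧ r t ≤ 1 ∧ inner ℝ (γ t).fst (Q t) = 1 - r t)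
    (hr' : ∀ᶠ t in 𝓝 t₀,
      deriv r t = 2 * inner ℝ ((γ t).fst - Q t) (deriv (fun t => (γ t).fst) t))
    (hQ' : ∀ᶠ t in 𝓝 t₀, 0 ≤ inner ℝ (deriv (fun t => (γ t).fst) t) (deriv Q t))
    (hvar : ∀ᶠ t in 𝓝 t₀, ∀ c ∈ Set.Ioo (-δ) δ, (γ t).fst - c • Q t ≠ 0 ∧
      normalizedVariation γ Q c t ∈ S ∧
      α (normalizedVariation γ Q c t) = ‖(γ t).fst - c • Q t‖ ^ 2 / r t) :
    0 ≤ deriv (deriv fun t => -Real.log (r t)) t₀ := by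
  by_contra! hneg
  set h := fun t => -Real.log (r t) with hh
  have hlog : ContDiffAt ℝ 2 h t₀ := (hr.log hrt.self_of_nhds.1.ne').neg
  have hcont := hlog.deriv_of_two.continuousAt_deriv_of_one
  have hneg' := hcont.eventually_lt_const hneg
  have hI' : ∀ᶠ t in 𝓝 t₀, t ∈ I := hI
  have hall := hI'.and <| (hγ.eventually (by simp)).and <| (hQ.eventually (by simp)).and <|
    (hr.eventually (by simp)).and <| (hlog.eventually (by simp)).and <| hM.eventually_nhds.and <|
    hrt.and <| hr'.and <| hQ'.and <| hvar.and hneg'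
  obtain ⟨a, b, ha, hb, hIcc⟩ := hall.exists_Icc
  clear hγ hQ hr hM hrt hr' hQ' hvar hlog hcont hneg' hall hneg hI'
  have hab : a < b := ha.trans hb
  have hII : Set.Icc a b ⊆ I := fun t ht => (hIcc t ht).1
  have hγ : ∀ t ∈ Set.Icc a b, ContDiffAt ℝ 2 γ t := fun t ht => (hIcc t ht).2.1
  have hQ : ∀ t ∈ Set.Icc a b, ContDiffAt ℝ 2 Q t := fun t ht => (hIcc t ht).2.2.1
  have hr : ∀ t ∈ Set.Icc a b, ContDiffAt ℝ 2 r t := fun t ht => (hIcc t ht).2.2.2.1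
  have hlog : ∀ t ∈ Set.Icc a b, ContDiffAt ℝ 2 h t := fun t ht => (hIcc t ht).2.2.2.2.1
  have hM : ∀ t ∈ Set.Icc a b, ∀ᶠ s in 𝓝 t, ‖(γ s).fst‖ = 1 :=
    fun t ht => (hIcc t ht).2.2.2.2.2.1
  have hrt : ∀ t ∈ Set.Icc a b, 0 < r t ∧ r t ≤ 1 ∧ inner ℝ (γ t).fst (Q t) = 1 - r t :=
    fun t ht => (hIcc t ht).2.2.2.2.2.2.1
  have hr' : ∀ t ∈ Set.Icc a b,
      deriv r t = 2 * inner ℝ ((γ t).fst - Q t) (deriv (fun t => (γ t).fst) t) :=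
    fun t ht => (hIcc t ht).2.2.2.2.2.2.2.1
  have hQ' : ∀ t ∈ Set.Icc a b, 0 ≤ inner ℝ (deriv (fun t => (γ t).fst) t) (deriv Q t) :=
    fun t ht => (hIcc t ht).2.2.2.2.2.2.2.2.1
  have hvar := fun t ht => (hIcc t ht).2.2.2.2.2.2.2.2.2.1
  have hneg : ∀ t ∈ Set.Icc a b, deriv (deriv h) t < 0 :=
    fun t ht => (hIcc t ht).2.2.2.2.2.2.2.2.2.2
  clear hIcc
  -- A bump vanishing at the end points; `η ≤ (b - a)^2` keeps `|s η| < δ` for `|s| < δ / (b -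
  -- a)^2`.
  set η := fun t => (t - a) * (b - t) with hη
  have hηd : ∀ t, HasDerivAt η (a + b - 2 * t) t := fun t =>
    ((((hasDerivAt_id t).sub_const a).fun_mul ((hasDerivAt_id t).const_sub b))).congr_deriv
      (by simp only [id]; ring)
  have hηc : ContDiff ℝ 2 η := by fun_prop
  have hη0 : ∀ t ∈ Set.Icc a b, 0 ≤ η t := fun t ht =>
    mul_nonneg (sub_nonneg.2 ht.1) (sub_nonneg.2 ht.2)
  have hη1 : ∀ t ∈ Set.Icc a b, η t ≤ (b - a) ^ 2 := fun t ht => by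
    simp only [hη]
    nlinarith [ht.1, ht.2]
  have hηpos : ∀ t ∈ Set.Ioo a b, 0 < η t := fun t ht =>
    mul_pos (sub_pos.2 ht.1) (sub_pos.2 ht.2)
  have hba : 0 < (b - a) ^ 2 := by have := sub_pos.2 hab; positivity
  set W := fun t => η t • Q t with hW
  have hsmall : ∀ s ∈ Set.Ioo (-(δ / (b - a) ^ 2)) (δ / (b - a) ^ 2), ∀ t ∈ Set.Icc a b,
      s * η t ∈ Set.Ioo (-δ) δ := by
    intro s hs t ht
    rw [Set.mem_Ioo, ← abs_lt] at hs ⊢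
    rw [abs_mul, abs_of_nonneg (hη0 t ht)]
    rw [lt_div_iff₀ hba] at hs
    exact (mul_le_mul_of_nonneg_left (hη1 t ht) (abs_nonneg s)).trans_lt hs
  have hWs : ∀ s t, s • W t = (s * η t) • Q t := fun s t => by simp only [hW, smul_smul]
  have hnv : ∀ s t, normalizedVariation γ W s t = normalizedVariation γ Q (s * η t) t := by
    intro s t
    simp only [normalizedVariation, hWs]
  have hWc : ∀ t ∈ Set.Icc a b, ContDiffAt ℝ 2 W t := fun t ht => hηc.contDiffAt.smul (hQ t ht)
  have hfv := integral_firstVariation_eq_zero hgeo (W := W) (r := r) (div_pos hδ hba) hab hII hγ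
    hWc (fun t ht => (hr t ht).continuousAt.continuousWithinAt) (fun t ht => (hrt t ht).1)
    (fun t ht => (hM t ht).self_of_nhds) (by simp [hW, hη]) (by simp [hW, hη])
    (fun s hs t ht => by
      rw [hWs]
      exact (hvar t ht _ (hsmall s hs t ht)).1)
    (fun s hs t ht => by
      rw [hnv]
      exact (hvar t ht _ (hsmall s hs t ht)).2.1)
    (fun s hs t ht => by
      rw [hnv, hWs]
      exact (hvar t ht _ (hsmall s hs t ht)).2.2)
  set M := fun t => (γ t).fst with hMdef
  set ζ := fun t => (γ t).snd with hζdef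
  have hMc : ∀ t ∈ Set.Icc a b, ContDiffAt ℝ 2 M t := fun t ht => (hγ t ht).fst_ofLp
  have hζc : ∀ t ∈ Set.Icc a b, ContDiffAt ℝ 2 ζ t := fun t ht => (hγ t ht).snd_ofLp
  -- The first variation integrand is `f + g / 2`, where `g = (η h')'` integrates to zero and `f >
  -- 0` inside.
  set f := fun t => η t * ((inner ℝ (deriv M t) (deriv Q t) + (1 - r t) * ‖deriv ζ t‖ ^ 2) / r t -
    1 / 2 * deriv (deriv h) t) with hf
  set g := fun t => (a + b - 2 * t) * deriv h t + η t * deriv (deriv h) t with hg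
  have cr : ContinuousOn r (Set.Icc a b) :=
    fun t ht => (hr t ht).continuousAt.continuousWithinAt
  have cM' : ContinuousOn (deriv M) (Set.Icc a b) :=
    fun t ht => (hMc t ht).deriv_of_two.continuousAt.continuousWithinAt
  have cζ' : ContinuousOn (deriv ζ) (Set.Icc a b) :=
    fun t ht => (hζc t ht).deriv_of_two.continuousAt.continuousWithinAt
  have cQ' : ContinuousOn (deriv Q) (Set.Icc a b) :=
    fun t ht => (hQ t ht).deriv_of_two.continuousAt.continuousWithinAt
  have ch' : ContinuousOn (deriv h) (Set.Icc a b) :=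
    fun t ht => (hlog t ht).deriv_of_two.continuousAt.continuousWithinAt
  have ch'' : ContinuousOn (deriv (deriv h)) (Set.Icc a b) := fun t ht =>
    (hlog t ht).deriv_of_two.continuousAt_deriv_of_one.continuousWithinAt
  have cη : ContinuousOn η (Set.Icc a b) := hηc.continuous.continuousOn
  have cf : ContinuousOn f (Set.Icc a b) :=
    cη.mul ((((cM'.inner cQ').add ((continuousOn_const.sub cr).mul (cζ'.norm.pow 2))).div cr
      fun t ht => (hrt t ht).1.ne').sub (continuousOn_const.mul ch''))
  have cg : ContinuousOn g (Set.Icc a b) :=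
    ((by fun_prop : ContinuousOn (fun t : ℝ => a + b - 2 * t) (Set.Icc a b)).mul ch').add
      (cη.mul ch'')
  have iF := cf.intervalIntegrable_of_Icc (μ := volume) hab.le
  have iG := cg.intervalIntegrable_of_Icc (μ := volume) hab.le
  have hgint : ∫ t in a..b, g t = 0 := by
    rw [intervalIntegral.integral_eq_sub_of_hasDerivAt (f := fun t => η t * deriv h t)
      (fun t ht => ?_) iG]
    · simp [hη]
    · rw [Set.uIcc_of_le hab.le] at ht
      exact (hηd t).fun_mul
        ((hlog t ht).deriv_of_two.differentiableAt one_ne_zero).hasDerivAt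
  have hfpos : 0 < ∫ t in a..b, f t := by
    refine intervalIntegral.intervalIntegral_pos_of_pos_on iF (fun t ht' => ?_) hab
    have ht := Set.Ioo_subset_Icc_self ht'
    obtain ⟨h1, h2, -⟩ := hrt t ht
    have h3 : 0 ≤ (inner ℝ (deriv M t) (deriv Q t) + (1 - r t) * ‖deriv ζ t‖ ^ 2) / r t :=
      div_nonneg (add_nonneg (hQ' t ht) (mul_nonneg (sub_nonneg.2 h2) (sq_nonneg _))) h1.le
    exact mul_pos (hηpos t ht') (by linarith [hneg t ht])
  have hsum : ∫ t in a..b, (f t + 1 / 2 * g t) = 0 := by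
    rw [← hfv]
    refine intervalIntegral.integral_congr fun t ht => ?_
    rw [Set.uIcc_of_le hab.le] at ht
    obtain ⟨h1, -, h3⟩ := hrt t ht
    have hMd := ((hMc t ht).differentiableAt two_ne_zero).hasDerivAt
    have hMM : inner ℝ (M t) (deriv M t) = 0 := by
      have hev : (fun s => ‖M s‖ ^ 2) =ᶠ[𝓝 t] fun _ => 1 := by
        filter_upwards [hM t ht] with s hs
        rw [show ‖M s‖ = 1 from hs, one_pow]
      have := (hMd.norm_sq.congr_of_eventuallyEq hev.symm).unique (hasDerivAt_const t 1)
      linarith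
    have hW' : deriv W t = η t • deriv Q t + (a + b - 2 * t) • Q t :=
      ((hηd t).fun_smul ((hQ t ht).differentiableAt two_ne_zero).hasDerivAt).deriv
    have hh' : deriv h t = -(deriv r t / r t) :=
      ((((hr t ht).differentiableAt two_ne_zero).hasDerivAt.log h1.ne').neg).deriv
    have hrr : deriv r t = -2 * inner ℝ (deriv M t) (Q t) := by
      rw [hr' t ht, inner_sub_left]
      change 2 * (inner ℝ (M t) (deriv M t) - inner ℝ (Q t) (deriv M t)) = _
      rw [hMM, real_inner_comm (deriv M t)]
      ring
    change f t + 1 / 2 * g t = (inner ℝ (deriv M t) (deriv W t) +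
      inner ℝ (M t) (W t) * ‖deriv ζ t‖ ^ 2) / r t
    have h3' : inner ℝ (M t) (W t) = η t * (1 - r t) := by
      rw [← h3]
      exact inner_smul_right _ _ _
    rw [hW', inner_add_right, inner_smul_right, inner_smul_right, h3']
    simp only [hf, hg, hh', hrr]
    field_simp
    ring
  rw [intervalIntegral.integral_add iF (iG.const_mul _), intervalIntegral.integral_const_mul,
    hgint] at hsum
  linarith

end Core

/-! ### Self-convexity on the solution variety -/

section SelfConvex

variable {K : Type*} [RCLike K] {n : ℕ}

theorem HasSimpleSmallest.sigma_zpow {M : MatSpace K n (n + 1)} {u : EuclideanSpace K (Fin n)}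
    {τ : ℝ} (h : HasSimpleSmallest M u τ) (hn : 1 ≤ n) :
    sigma n M ^ (-2 : ℤ) = (‖M.adj u‖ ^ 2)⁻¹ := by
  rw [h.sigma_eq hn n.le_succ, zpow_neg]
  rfl

theorem ContDiffAt.matSpace_adj {m : ℕ} {E : Type*} [NormedAddCommGroup E] [NormedSpace ℝ E]
    {k : WithTop ℕ∞} {f : E → MatSpace K n m} {g : E → EuclideanSpace K (Fin n)} {x : E}
    (hf : ContDiffAt ℝ k f x) (hg : ContDiffAt ℝ k g x) :
    ContDiffAt ℝ k (fun y => MatSpace.adj (f y) (g y)) x := by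
  have h : ContDiff ℝ k fun p : MatSpace K n m × EuclideanSpace K (Fin n) =>
      MatSpace.adjL p.1 p.2 := by fun_prop
  have h' := ContDiffAt.comp (g := fun p : MatSpace K n m × EuclideanSpace K (Fin n) =>
    MatSpace.adjL p.1 p.2) (f := fun y => (f y, g y)) x h.contDiffAt (hf.prodMk hg)
  simpa only [Function.comp_def, MatSpace.adjL_apply] using h'

theorem ContDiffAt.matSpace_resid {m : ℕ} {E : Type*} [NormedAddCommGroup E] [NormedSpace ℝ E]
    {k : WithTop ℕ∞} {f : E → MatSpace K n m} {g : E → EuclideanSpace K (Fin n)} {x : E}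
    (hf : ContDiffAt ℝ k f x) (hg : ContDiffAt ℝ k g x) :
    ContDiffAt ℝ k (fun y => MatSpace.resid (g y) (f y)) x := by
  have h : ContDiff ℝ k fun p : EuclideanSpace K (Fin n) × EuclideanSpace K (Fin m) =>
      MatSpace.outerL p.1 p.2 := by fun_prop
  have h' := ContDiffAt.comp (g := fun p : EuclideanSpace K (Fin n) × EuclideanSpace K (Fin m) =>
    MatSpace.outerL p.1 p.2) (f := fun y => (g y, MatSpace.adj (f y) (g y))) x h.contDiffAt
    (hg.prodMk (hf.matSpace_adj hg))
  simp only [Function.comp_def, MatSpace.outerL_apply] at h'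
  simpa only [MatSpace.resid] using hf.sub h'

theorem isC2OnSubmanifold_sigma (hn : 1 ≤ n) :
    IsC2OnSubmanifold (solutionVariety K n) (fun w => sigma n w.fst ^ (-2 : ℤ)) := by
  intro p hp
  obtain ⟨u₀, τ₀, h₀⟩ := exists_hasSimpleSmallest hn n.le_succ hp.2.2.1
  obtain ⟨u, ρ, τ, -, hu, hev⟩ := h₀.exists_contDiffAt
  have hfst : ContDiff ℝ 2 (fun w : PairSpace K n => w.fst) :=
    ContDiff.comp (g := Prod.fst) (f := WithLp.prodContinuousLinearEquiv 2 ℝ _ _) contDiff_fst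
      (ContinuousLinearEquiv.contDiff _)
  have hu' : ContDiffAt ℝ 2 (fun w : PairSpace K n => u w.fst) p :=
    ContDiffAt.comp (g := u) (f := fun w : PairSpace K n => w.fst) p hu hfst.contDiffAt
  have hadj : ContDiffAt ℝ 2 (fun w : PairSpace K n => MatSpace.adj w.fst (u w.fst)) p :=
    hfst.contDiffAt.matSpace_adj hu'
  refine ⟨fun w => (‖MatSpace.adj w.fst (u w.fst)‖ ^ 2)⁻¹, ?_, ?_⟩
  · exact (hadj.norm_sq ℝ).inv (pow_ne_zero 2 hev.self_of_nhds.1.pos.ne')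
  · filter_upwards [(hfst.continuous.continuousAt.eventually hev).filter_mono
      nhdsWithin_le_nhds] with w hw
    exact (hw.1.sigma_zpow hn).symm

theorem sigma_zpow_pos (hn : 1 ≤ n) {w : PairSpace K n} (hw : w ∈ solutionVariety K n) :
    0 < sigma n w.fst ^ (-2 : ℤ) := by
  obtain ⟨u, τ, h⟩ := exists_hasSimpleSmallest hn n.le_succ hw.2.2.1
  rw [h.sigma_zpow hn]
  exact inv_pos.2 (pow_pos h.pos 2)

theorem IsC2OnSubmanifold.continuousOn {E : Type*} [NormedAddCommGroup E] [InnerProductSpace ℝ E]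
    {S : Set E} {α : E → ℝ} (h : IsC2OnSubmanifold S α) : ContinuousOn α S := by
  intro p hp
  obtain ⟨β, hβ, hev⟩ := h p hp
  exact hβ.continuousAt.continuousWithinAt.congr_of_eventuallyEq hev.symm
    (hev.self_of_nhdsWithin hp).symm

theorem MatSpace.norm_adj_le {m : ℕ} {u : EuclideanSpace K (Fin n)} (hu : ‖u‖ = 1)
    (A : MatSpace K n m) : ‖A.adj u‖ ^ 2 ≤ ‖A‖ ^ 2 := by
  have := MatSpace.norm_sq_resid hu A
  nlinarith [sq_nonneg ‖MatSpace.resid u A‖]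

/-- Envelope argument: with `u t` frozen, `‖M(s)^* u(t)‖^2` touches the minimum `r` from above at `s
= t`, so the derivative of `u` plays no part. -/
theorem HasSimpleSmallest.deriv_norm_sq_adj {m : ℕ} {M : ℝ → MatSpace K n m}
    {u : ℝ → EuclideanSpace K (Fin n)} {τ t : ℝ}
    (hs : ∀ᶠ s in 𝓝 t, HasSimpleSmallest (M s) (u s) τ) (hM : DifferentiableAt ℝ M t)
    (hr : DifferentiableAt ℝ (fun s => ‖MatSpace.adj (M s) (u s)‖ ^ 2) t) :
    deriv (fun s => ‖MatSpace.adj (M s) (u s)‖ ^ 2) t =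
      2 * inner ℝ (M t - MatSpace.resid (u t) (M t)) (deriv M t) := by
  have hst := hs.self_of_nhds
  have had : HasDerivAt (fun s => MatSpace.adjL (M s) (u t))
      (MatSpace.adjL (deriv M t) (u t)) t :=
    ((MatSpace.adjL (K := K) (n := n) (m := m)).flip (u t)).hasFDerivAt.comp_hasDerivAt
      (f := M) t hM.hasDerivAt
  have hmin : IsLocalMin
      (fun s => ‖MatSpace.adjL (M s) (u t)‖ ^ 2 - ‖MatSpace.adj (M s) (u s)‖ ^ 2) t := by
    filter_upwards [hs] with s hs'
    have := hs'.le_norm_sq_adj (u t)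
    rw [hst.norm_eq, one_pow, mul_one] at this
    simp only [MatSpace.adjL_apply, sub_self]
    linarith
  have hz := hmin.hasDerivAt_eq_zero (had.norm_sq.fun_sub hr.hasDerivAt)
  rw [MatSpace.resid, sub_sub_cancel, MatSpace.inner_outer]
  simp only [MatSpace.adjL_apply] at hz
  linarith

/-- The residual kills `ζ` because `⟪M^* u, ζ⟫ = ⟪u, M ζ⟫ = 0`. As `σ_n(Z) = σ_n(M)`, normalizing
only divides it by `‖Z‖`. -/
theorem HasSimpleSmallest.normalize_mem_solutionVariety {w : PairSpace K n}
    (hw : w ∈ solutionVariety K n) (hn : 1 ≤ n) {u : EuclideanSpace K (Fin n)} {τ c : ℝ}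
    (h : HasSimpleSmallest w.fst u τ) (hc : ‖MatSpace.adj w.fst u‖ ^ 2 < (1 - c) ^ 2 * τ)
    {Z : MatSpace K n (n + 1)} (hZdef : Z = w.fst - c • MatSpace.resid u w.fst) :
    Z ≠ 0 ∧ WithLp.toLp 2 (‖Z‖⁻¹ • Z, w.snd) ∈ solutionVariety K n ∧
      sigma n (‖Z‖⁻¹ • Z) ^ (-2 : ℤ) = ‖Z‖ ^ 2 / ‖MatSpace.adj w.fst u‖ ^ 2 := by
  have hZ := h.sub_smul_resid hc
  have hadj := h.sub_smul_resid_adj c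
  rw [← hZdef] at hZ hadj
  have hZ0 : Z ≠ 0 := by
    intro h0
    have := hZ.pos
    rw [h0, ← MatSpace.adjL_apply, map_zero, zero_apply, norm_zero] at this
    exact this.false
  have hN0 : ‖Z‖ ≠ 0 := norm_ne_zero_iff.2 hZ0
  have hN := hZ.smul (inv_ne_zero hN0)
  have h0 : MatSpace.linL w.fst w.snd = 0 :=
    (MatSpace.linL_apply_eq_zero_iff _ _).2 hw.2.2.2
  have hq : MatSpace.linL (MatSpace.resid u w.fst) w.snd = 0 := by
    rw [MatSpace.resid, map_sub, sub_apply, h0, MatSpace.linL_outer, ← MatSpace.inner_lin, h0,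
      inner_zero_right, zero_smul, sub_zero]
  have hl : MatSpace.linL (‖Z‖⁻¹ • Z) w.snd = 0 := by
    rw [hZdef, map_smul, map_sub, map_smul, smul_apply, sub_apply, smul_apply, h0, hq, smul_zero,
      sub_zero, smul_zero]
  refine ⟨hZ0, ⟨?_, hw.2.1, hN.mem_GLgt n.le_succ,
    (MatSpace.linL_apply_eq_zero_iff _ _).1 hl⟩, ?_⟩
  · change ‖‖Z‖⁻¹ • Z‖ = 1
    rw [norm_smul, norm_inv, norm_norm, inv_mul_cancel₀ hN0]
  · rw [hN.sigma_zpow hn, ← MatSpace.adjL_apply, map_smul, smul_apply, MatSpace.adjL_apply, hadj,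
      norm_smul, norm_inv, norm_norm, mul_pow, inv_pow, mul_inv, inv_inv, div_eq_mul_inv]

/-- Near a matrix of a condition geodesic, `-log (σ_n ^ 2)` is of class `C²` along the geodesic, and
its second derivative is nonnegative. -/
theorem exists_contDiffAt_log_sigma (hn : 1 ≤ n) {I : Set ℝ} {γ : ℝ → PairSpace K n}
    (hgeo : IsConditionGeodesic (solutionVariety K n) (fun w => sigma n w.fst ^ (-2 : ℤ)) I γ)
    {t₀ : ℝ} (hI : I ∈ 𝓝 t₀) :
    ContDiffAt ℝ 2 (fun t => Real.log (sigma n (γ t).fst ^ (-2 : ℤ))) t₀ ∧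
      0 ≤ deriv (deriv fun t => Real.log (sigma n (γ t).fst ^ (-2 : ℤ))) t₀ := by
  have hγ : ContDiffAt ℝ 2 γ t₀ := hgeo.1.contDiffAt hI
  have hp := hgeo.2.1 t₀ (mem_of_mem_nhds hI)
  obtain ⟨u₀, τ₀, h₀⟩ := exists_hasSimpleSmallest hn n.le_succ hp.2.2.1
  obtain ⟨v, ρ, τ, hρτ, hv, hev⟩ := h₀.exists_contDiffAt
  have hMc : ContDiffAt ℝ 2 (fun t => (γ t).fst) t₀ := hγ.fst_ofLp
  set M := fun t => (γ t).fst with hM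
  set u := fun t => v (M t) with hu
  have huc : ContDiffAt ℝ 2 u t₀ := ContDiffAt.comp (g := v) (f := M) t₀ hv hMc
  have hac : ContDiffAt ℝ 2 (fun t => MatSpace.adj (M t) (u t)) t₀ := hMc.matSpace_adj huc
  set r := fun t => ‖MatSpace.adj (M t) (u t)‖ ^ 2 with hr
  have hrc : ContDiffAt ℝ 2 r t₀ := hac.norm_sq ℝ
  have hQc : ContDiffAt ℝ 2 (fun t => MatSpace.resid (u t) (M t)) t₀ :=
    hMc.matSpace_resid huc
  set Q := fun t => MatSpace.resid (u t) (M t) with hQ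
  have hsing : ∀ᶠ t in 𝓝 t₀, HasSimpleSmallest (M t) (u t) τ ∧ r t ≤ ρ :=
    hMc.continuousAt.eventually hev
  have hS : ∀ᶠ t in 𝓝 t₀, γ t ∈ solutionVariety K n := by
    filter_upwards [hI] with t ht using hgeo.2.1 t ht
  have hlog : (fun t => Real.log (sigma n (γ t).fst ^ (-2 : ℤ))) =ᶠ[𝓝 t₀]
      fun t => -Real.log (r t) := by
    filter_upwards [hsing] with t ht
    rw [show sigma n (γ t).fst ^ (-2 : ℤ) = _ from ht.1.sigma_zpow hn, Real.log_inv]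
  have hr0 : r t₀ ≠ 0 := pow_ne_zero 2 hsing.self_of_nhds.1.pos.ne'
  refine ⟨((hrc.log hr0).neg).congr_of_eventuallyEq hlog, ?_⟩
  rw [hlog.deriv.deriv_eq]
  -- For `|c| < δ`, the scaled squares remain at least `(1 - δ)^2 τ > ρ ≥ r`, so `u` keeps its role.
  obtain ⟨δ, hδ0, hδ1, hδ⟩ : ∃ δ > 0, δ < 1 ∧ ρ < (1 - δ) ^ 2 * τ := by
    have hc : Filter.Tendsto (fun d : ℝ => (1 - d) ^ 2 * τ) (𝓝[>] 0) (𝓝 τ) := by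
      have : Continuous fun d : ℝ => (1 - d) ^ 2 * τ := by fun_prop
      simpa using (this.tendsto 0).mono_left nhdsWithin_le_nhds
    obtain ⟨δ, ⟨h1, h2⟩, h3⟩ :=
      ((hc.eventually_const_lt hρτ).and (Ioo_mem_nhdsGT one_pos)).exists.imp
        fun d hd => (⟨hd.2, hd.1⟩ : d ∈ Set.Ioo (0 : ℝ) 1 ∧ _)
    exact ⟨δ, h1, h2, h3⟩
  have hMM : ∀ t, inner ℝ (M t) (Q t) = ‖M t‖ ^ 2 - r t := by
    intro t
    rw [real_inner_comm, hQ, MatSpace.inner_resid, real_inner_self_eq_norm_sq,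
      real_inner_self_eq_norm_sq]
  refine deriv_two_neg_log_nonneg hgeo hδ0 hI hγ hQc hrc ?_ ?_ ?_ ?_ ?_
  · filter_upwards [hS] with t ht using ht.1
  · filter_upwards [hS, hsing] with t ht hs
    refine ⟨pow_pos hs.1.pos 2, ?_, ?_⟩
    · have := MatSpace.norm_adj_le hs.1.norm_eq (M t)
      rwa [show ‖M t‖ = 1 from ht.1, one_pow] at this
    · change inner ℝ (M t) (Q t) = _
      rw [hMM, show ‖M t‖ = 1 from ht.1, one_pow]
  · filter_upwards [hsing.eventually_nhds, hMc.eventually (by simp), hrc.eventually (by simp)]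
      with t hs hMt hrt
    exact HasSimpleSmallest.deriv_norm_sq_adj (hs.mono fun _ h => h.1)
      (hMt.differentiableAt two_ne_zero) (hrt.differentiableAt two_ne_zero)
  · filter_upwards [hsing.eventually_nhds, hMc.eventually (by simp), hQc.eventually (by simp)]
      with t hs hMt hQt
    refine inner_deriv_nonneg_of_monotone (hMt.differentiableAt two_ne_zero).hasDerivAt
      (hQt.differentiableAt two_ne_zero).hasDerivAt ?_
    filter_upwards [hs] with s hs'
    exact hs'.1.inner_sub_resid_nonneg hs.self_of_nhds.1
  · filter_upwards [hS, hsing] with t ht hs c hc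
    have hcc : r t < (1 - c) ^ 2 * τ := by
      refine hs.2.trans_lt (hδ.trans_le ?_)
      have hτ : 0 ≤ τ := (sq_nonneg _).trans hs.1.lt.le
      refine mul_le_mul_of_nonneg_right (pow_le_pow_left₀ ?_ ?_ 2) hτ
      · linarith
      · linarith [hc.2]
    exact hs.1.normalize_mem_solutionVariety ht hn hcc rfl

theorem isSelfConvex_sigma (hn : 1 ≤ n) :
    IsSelfConvex (solutionVariety K n) (fun w => sigma n w.fst ^ (-2 : ℤ)) where
  c2 := isC2OnSubmanifold_sigma hn
  pos _ hw := sigma_zpow_pos hn hw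
  convex I γ hI hgeo := by
    have key : ∀ t ∈ interior I, _ := fun t ht =>
      exists_contDiffAt_log_sigma hn hgeo (mem_interior_iff_mem_nhds.1 ht)
    -- End points in `I` need only continuity; the second derivative is used in the interior.
    refine convexOn_of_deriv2_nonneg hI.convex ?_ ?_ ?_ ?_
    · exact ((isC2OnSubmanifold_sigma hn).continuousOn.comp hgeo.1.continuousOn hgeo.2.1).log
        fun t ht => (sigma_zpow_pos hn (hgeo.2.1 t ht)).ne'
    · exact fun t ht => ((key t ht).1.differentiableAt two_ne_zero).differentiableWithinAt
    · exact fun t ht =>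
        ((key t ht).1.deriv_of_two.differentiableAt one_ne_zero).differentiableWithinAt
    · exact fun t ht => (key t ht).2

end SelfConvex

theorem theorem3 (K : Type*) [RCLike K] (n : ℕ) (hn : 1 ≤ n) :
    IsEmbeddedSubmanifold (solutionVariety K n) ∧
      IsSelfConvex (solutionVariety K n) (fun w => sigma n w.fst ^ (-2 : ℤ)) :=
  ⟨isEmbeddedSubmanifold_solutionVariety hn, isSelfConvex_sigma hn⟩
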